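/- Let $N\ge n\ge 1$. A real hypersurface below is an embedded (not necessarily closed) real submanifold of real codimension one; it is called real algebraic if it is real analytic and contained in the zero set of a nonzero real polynomial. Let $M\subset\mathbb C^n$ be a real analytic hypersurface, let $p\in M$, and let $U\subset\mathbb C^n$ be an open neighborhood of $p$ such that $U\setminus M$ is the disjoint union of two open sets (the two sides of $M$ in $U$), each of which has $M\cap U$ in its boundary; let $\Omega$ be one of these two sides. Let $M'\subset\mathbb C^N$ be a strongly pseudoconvex real algebraic hypersurface (for a suitable sign of a local defining function, the Levi form is positive definite on the complex tangent space at every point of $M'$), and let $q\in M'$. Assume that near $q$ the hypersurface $M'$ is equivalent to a model $$\{(z',z_N')\in\mathbb C^{N-1}\times\mathbb C:\ \mathrm{Im}\,z_N'=P(z',\bar z')\},$$ where $P$ is a real-valued polynomial in $z',\bar z'$, by a birational change of coordinates that is biholomorphic near $q$; that is, there are open sets $V'\ni q$ and $W'$ in $\mathbb C^N$ and a bijection $\Phi:V'\to W'$ such that $\Phi$ and $\Phi^{-1}$ are given by rational functions whose denominators do not vanish on $V'$ and $W'$, respectively, and $\Phi(M'\cap V')$ is the intersection of the model with $W'$. Let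 $F$ be a meromorphic mapping from $U$ to $\mathbb C^N$ (near every point of $U$, $F=f/g$ with $f$ a holomorphic mapping into $\mathbb C^N$ and $g\not\equiv 0$ a holomorphic function on a connected neighborhood). Suppose that $F$ is holomorphic on $\Omega$, that $F(\Omega)$ lies on one side of $M'$ (one of the two sides, in the sense above, of $M'$ in some open set containing $q$), that $F|_\Omega$ extends continuously to $\overline\Omega\cap U$, and that, with $F(z):=\lim_{\Omega\ni\zeta\to z}F(\zeta)$ for $z\in M\cap U$, one has $F(M\cap U)\subset M'$ and $F(p)=q$. Then $F$ extends holomorphically to a neighborhood of $p$: there are an open neighborhood $V\subset U$ of $p$ and a holomorphic mapping $G:V\to\mathbb C^N$ with $G=F$ on $V\cap\overline\Omega$ and at every point of $V$ where $F$ is holomorphic. -/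

import Mathlib

open Set Topology

/-- `ℂⁿ`; only its topology and its vector space structure matter below. -/
abbrev Cn (n : ℕ) : Type := Fin n → ℂ

/-- The value at `z` of a polynomial `P(z, z̄)`: the variables `Sum.inl j` stand for `z_j`,
the variables `Sum.inr j` for the conjugates `z̄_j`. -/
noncomputable def evalConj {k : ℕ} (P : MvPolynomial (Fin k ⊕ Fin k) ℂ) (z : Cn k) : ℂ :=
  MvPolynomial.eval (Sum.elim z (fun j => (starRingEnd ℂ) (z j))) P

/-- The polynomial `P(z, z̄)` takes real values only. -/
def IsRealValued {k : ℕ} (P : MvPolynomial (Fin k ⊕ Fin k) ℂ) : Prop :=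
  ∀ z : Cn k, (evalConj P z).im = 0

/-- `r` is a real analytic local defining function of the set `M` at `x`, on the open
neighborhood `V` of `x`. -/
structure IsDefiningFunctionAt {k : ℕ} (M : Set (Cn k)) (x : Cn k) (V : Set (Cn k))
    (r : Cn k → ℝ) : Prop where
  isOpen : IsOpen V
  mem : x ∈ V
  analytic : AnalyticOnNhd ℝ r V
  fderiv_ne_zero : fderiv ℝ r x ≠ 0
  zero_iff : ∀ y ∈ V, y ∈ M ↔ r y = 0

/-- A (smooth, not necessarily closed) real analytic real hypersurface of `ℂᵏ`. -/
def IsRealAnalyticHypersurface {k : ℕ} (M : Set (Cn k)) : Prop :=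
  ∀ x ∈ M, ∃ V r, IsDefiningFunctionAt M x V r

/-- A real algebraic hypersurface of `ℂᵏ`: a smooth real analytic hypersurface contained in the
zero set of a nonzero real polynomial. -/
def IsRealAlgebraicHypersurface {k : ℕ} (M : Set (Cn k)) : Prop :=
  IsRealAnalyticHypersurface M ∧
    ∃ P : MvPolynomial (Fin k ⊕ Fin k) ℂ, P ≠ 0 ∧ IsRealValued P ∧ ∀ z ∈ M, evalConj P z = 0

/-- The Levi form `∑ (∂²r / ∂z_j ∂z̄_l)(x) v_j v̄_l`, written through the real Hessian of `r`:
it equals `(D²r(v, v) + D²r(iv, iv)) / 4`. -/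
noncomputable def leviForm {k : ℕ} (r : Cn k → ℝ) (x v : Cn k) : ℝ :=
  (fderiv ℝ (fderiv ℝ r) x v v
    + fderiv ℝ (fderiv ℝ r) x (Complex.I • v) (Complex.I • v)) / 4

/-- `v` lies in the complex tangent space of `{r = 0}` at `x`, i.e. `∑ (∂r/∂z_j)(x) v_j = 0`. -/
def IsComplexTangent {k : ℕ} (r : Cn k → ℝ) (x v : Cn k) : Prop :=
  fderiv ℝ r x v = 0 ∧ fderiv ℝ r x (Complex.I • v) = 0

/-- Strong pseudoconvexity: at each point, for a suitable choice of the local defining function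
(that is, of its sign), the Levi form is positive definite on the complex tangent space. -/
def IsStronglyPseudoconvex {k : ℕ} (M : Set (Cn k)) : Prop :=
  ∀ x ∈ M, ∃ V r, IsDefiningFunctionAt M x V r ∧
    ∀ v : Cn k, v ≠ 0 → IsComplexTangent r x v → 0 < leviForm r x v

/-- The model hypersurface `{Im z_N = P(z', z̄')}` of `ℂᴺ`, `N = m + 1`, `z = (z', z_N)`. -/
def modelHypersurface {m : ℕ} (P : MvPolynomial (Fin m ⊕ Fin m) ℂ) : Set (Cn (m + 1)) :=
  {z | (((z (Fin.last m)).im : ℝ) : ℂ) = evalConj P (Fin.init z)}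

/-- On `V`, all components of `Φ` are quotients of holomorphic polynomials whose denominators
have no zero in `V`. -/
def IsRegularRationalOn {k : ℕ} (Φ : Cn k → Cn k) (V : Set (Cn k)) : Prop :=
  ∀ j, ∃ P Q : MvPolynomial (Fin k) ℂ, ∀ z ∈ V,
    MvPolynomial.eval z Q ≠ 0 ∧ Φ z j = MvPolynomial.eval z P / MvPolynomial.eval z Q

/-- Near `q`, the set `M` is carried onto an open piece of `S` by a birational change of
coordinates that is biholomorphic near `q`: a rational map `Φ`, regular on an open
neighborhood `V` of `q`, with a rational inverse `Ψ`, regular on the open set `W = Φ(V)`,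
such that `Φ(M ∩ V) = S ∩ W`. -/
def IsBirationallyEquivalentAt {k : ℕ} (M S : Set (Cn k)) (q : Cn k) : Prop :=
  ∃ (Φ Ψ : Cn k → Cn k) (V W : Set (Cn k)),
    IsOpen V ∧ IsOpen W ∧ q ∈ V ∧
    MapsTo Φ V W ∧ MapsTo Ψ W V ∧ LeftInvOn Ψ Φ V ∧ RightInvOn Ψ Φ W ∧
    IsRegularRationalOn Φ V ∧ IsRegularRationalOn Ψ W ∧
    ∀ z ∈ V, z ∈ M ↔ Φ z ∈ S

/-- `D` is the part of `U` lying on one side of `M`: the complement of `M` in `U` is the disjoint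
union of the two open sets `D` and `D'` (the two sides), and `M ∩ U` is contained in the
boundary of each of them. -/
def IsOneSide {k : ℕ} (M U D : Set (Cn k)) : Prop :=
  IsOpen D ∧ ∃ D', IsOpen D' ∧ Disjoint D D' ∧ U \ M = D ∪ D' ∧
    M ∩ U ⊆ closure D ∧ M ∩ U ⊆ closure D'

/-- `F` represents a meromorphic map from the open set `U ⊆ ℂⁿ` to `ℂᴺ`: near each point of `U` it
is a quotient `f / g` of a holomorphic map and a holomorphic function that vanishes on no
nonempty open set. The values of `F` at zeros of `g` are not restricted. -/
def IsMeromorphicMapOn {n N : ℕ} (F : Cn n → Cn N) (U : Set (Cn n)) : Prop :=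
  ∀ x ∈ U, ∃ (V : Set (Cn n)) (f : Cn n → Cn N) (g : Cn n → ℂ),
    IsOpen V ∧ x ∈ V ∧ V ⊆ U ∧ AnalyticOnNhd ℂ f V ∧ AnalyticOnNhd ℂ g V ∧
    V ⊆ closure {z ∈ V | g z ≠ 0} ∧
    ∀ z ∈ V, g z ≠ 0 → F z = (g z)⁻¹ • f z

/-! Near `p` write `F = f / g`. Choose a direction `e`, transverse to `M`, such that `g (p + ζ e)`
vanishes at most at `ζ = 0` on a small disc. The candidate extension is the Cauchy integral `G z =
(2πi)⁻¹ ∮ F (z + ζ e) dζ / ζ` over a fixed circle in that disc. For `z` near `p` the circles avoid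
the zeros of `g`, so `G` is holomorphic near `p`, and all that has to be shown is `f = g G`
(`exists_analyticAt_eq_smul`).

For fixed `z` this is a question on the bidisc slice `(t, ζ) ↦ p + t (z - p) + ζ e`. Expand `F` in
powers of `t`: the coefficients are meromorphic in `ζ`, with a pole at `0` at worst. If none of them
has a pole, then `f = g A + t ^ l B` with `A`, `B` holomorphic, for every `l`
(`exists_analyticOnNhd_expansion`). Cauchy's formula reproduces `A`, so `f - g G` on `ζ = 0` is `O(t
^ l)` for all `l`, hence zero for all `t`, in particular at `t = 1` (`eq_smul_circleIntegral`).

The heart is the absence of poles. For the coefficient of order `0` it follows from continuity of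
`F` along `M`. For order `l ≥ 1`, let the terms of lower order be holomorphic and let the next one
behave like `β ζ ^ (-a)` with `a ≥ 1`, `β ≠ 0`. Polarize a defining function of `M'` to `R`, so that
`R (F, F̄) = 0` holds on the complexification of `M`, and expand this equation in `(τ, σ)` around
points `(0, z)` of `M` that tend to `p`, along Segre curves (`exists_segre_family`). The coefficient
of `τ ^ l`, multiplied by `z ^ a`, shows in the limit that `β` is complex tangent to `M'` at `q`.
The coefficient of `τ ^ l σ ^ l`, multiplied by `|z| ^ (2a)`, shows that the Levi form vanishes on
`β` (`tangent_and_levi_of_polarized_equation`). This contradicts strong pseudoconvexity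
(`not_pole_of_leviForm_pos`). -/

/-! ### Analyticity of integrals with respect to a parameter -/

open Filter MeasureTheory in
/-- The integral of an analytic family over a set of parameters on which one power series
expansion is valid is analytic. -/
lemma analyticAt_setIntegral_of_hasFPowerSeriesOnBall {E F : Type*}
    [NormedAddCommGroup E] [NormedSpace ℂ E] [NormedAddCommGroup F] [NormedSpace ℂ F]
    [CompleteSpace F] {H : E × ℂ → F} {q : FormalMultilinearSeries ℂ (E × ℂ) F} {y₀ : E} {z₀ : ℂ}
    {r : NNReal} (hr : 0 < r) (hH : HasFPowerSeriesOnBall H q (y₀, z₀) (r + r + r))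
    {γ : ℝ → ℂ} (hγ : Continuous γ) {T : Set ℝ} (hT : MeasurableSet T) (hfin : volume T ≠ ⊤)
    (hTr : ∀ t ∈ T, ‖γ t - z₀‖₊ ≤ r) :
    AnalyticAt ℂ (fun y => ∫ t in T, H (y, γ t)) y₀ := by
  have : IsFiniteMeasure (volume.restrict T) := ⟨by simpa using! hfin.lt_top⟩
  -- The series is re-centred at `(y₀, γ t)`, at distance at most `r` from the old centre. As `r +
  -- r` is below the radius of convergence, the re-centred coefficients have, on the ball of radius
  -- `r`, summable majorants `a k` that do not depend on `t`.
  set u : ℝ → E × ℂ := fun t => (0, γ t - z₀) with hu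
  have hunorm : ∀ t ∈ T, ‖u t‖₊ ≤ r := fun t ht => by
    have := hTr t ht
    simpa [hu, Prod.nnnorm_def] using this
  have hr3 : (r + r : ENNReal) < r + r + r := by
    have : (r + r : NNReal) < r + r + r := by simpa using hr
    exact_mod_cast this
  have hrad : ((r : ENNReal) + r) < q.radius := hr3.trans_le hH.r_le
  have hr1 : (r : ENNReal) < q.radius := lt_of_le_of_lt le_self_add hrad
  have hsum := q.changeOriginSeries_summable_aux₁ hrad
  have hsum' := NNReal.summable_sigma.1 hsum
  set a : ℕ → NNReal := fun k => ∑' s : Σ l : ℕ, { s : Finset (Fin (k + l)) // s.card = l },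
    ‖q (k + s.1)‖₊ * r ^ s.1 * r ^ k with ha
  have hasum : Summable a := hsum'.2
  have hbound : ∀ t ∈ T, ∀ k, ‖q.changeOrigin (u t) k‖₊ * r ^ k ≤ a k := by
    intro t ht k
    have h1 : ((‖u t‖₊ : NNReal) : ENNReal) < q.radius :=
      lt_of_le_of_lt (by exact_mod_cast hunorm t ht) hr1
    refine (mul_le_mul_left (q.nnnorm_changeOrigin_le k h1) _).trans ?_
    rw [← NNReal.tsum_mul_right]
    refine Summable.tsum_le_tsum (fun s => ?_) ?_ (hsum'.1 k)
    · have := hunorm t ht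
      gcongr
    · refine NNReal.summable_of_le (fun s => ?_) (hsum'.1 k)
      have := hunorm t ht
      gcongr
  let inlE : E →L[ℂ] E × ℂ := ContinuousLinearMap.inl ℂ E ℂ
  have hinl : ‖inlE‖ ≤ 1 := ContinuousLinearMap.norm_inl_le_one ℂ E ℂ
  let c : ∀ k : ℕ, ((E × ℂ) [×k]→L[ℂ] F) →L[ℂ] (E [×k]→L[ℂ] F) := fun k =>
    ContinuousMultilinearMap.compContinuousLinearMapL (fun _ : Fin k => inlE)
  let P : ℝ → ∀ k : ℕ, (E [×k]→L[ℂ] F) := fun t k => c k (q.changeOrigin (u t) k)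
  have hPnorm : ∀ t ∈ T, ∀ k, ‖P t k‖ * (r : ℝ) ^ k ≤ a k := by
    intro t ht k
    have h1 : ‖P t k‖ ≤ ‖q.changeOrigin (u t) k‖ := by
      refine (ContinuousMultilinearMap.norm_compContinuousLinearMap_le _ _).trans ?_
      refine mul_le_of_le_one_right (norm_nonneg _) ?_
      exact Finset.prod_le_one (fun _ _ => norm_nonneg _) (fun _ _ => hinl)
    refine (mul_le_mul_of_nonneg_right h1 (by positivity)).trans ?_
    exact_mod_cast hbound t ht k
  have hrpos : (0 : ℝ) < r := by exact_mod_cast hr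
  have hPmeas : ∀ k, AEStronglyMeasurable (fun t => P t k) (volume.restrict T) := by
    intro k
    refine ContinuousOn.aestronglyMeasurable ?_ hT
    refine (c k).continuous.comp_continuousOn ?_
    have h2 := (q.hasFPowerSeriesOnBall_changeOrigin k (lt_of_le_of_lt zero_le hr1)).continuousOn
    refine h2.comp (by fun_prop) ?_
    intro t ht
    rw [Metric.mem_eball, edist_zero_right]
    exact lt_of_le_of_lt (by exact_mod_cast hunorm t ht) hr1
  have hPint : ∀ k, Integrable (fun t => P t k) (volume.restrict T) := by
    intro k
    refine Integrable.of_bound (hPmeas k) (a k / (r : ℝ) ^ k) ?_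
    refine (ae_restrict_iff' hT).2 (Eventually.of_forall fun t ht => ?_)
    rw [le_div_iff₀ (by positivity)]
    exact hPnorm t ht k
  let p : FormalMultilinearSeries ℂ E F := fun k => ∫ t in T, P t k
  refine ⟨p, r, ?_, by exact_mod_cast hr, ?_⟩
  · refine p.le_radius_of_bound ((∑' k, (a k : ℝ)) * volume.real T) fun k => ?_
    have h1 : ‖p k‖ ≤ (a k / (r : ℝ) ^ k) * volume.real T := by
      refine norm_setIntegral_le_of_norm_le_const hfin.lt_top (fun t ht => ?_)
      rw [le_div_iff₀ (by positivity)]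
      exact hPnorm t ht k
    calc ‖p k‖ * (r : ℝ) ^ k ≤ (a k / (r : ℝ) ^ k) * volume.real T * (r : ℝ) ^ k := by gcongr
      _ = a k * volume.real T := by field_simp
      _ ≤ _ := by
        gcongr
        exact (NNReal.summable_coe.2 hasum).le_tsum k (fun _ _ => NNReal.coe_nonneg _)
  · intro y hy
    have hy' : ‖y‖₊ < r := by
      rw [Metric.mem_eball, edist_zero_right] at hy
      exact_mod_cast hy
    have hlim : HasSum (fun k => ∫ t in T, P t k fun _ => y) (∫ t in T, H (y₀ + y, γ t)) := by
      refine hasSum_integral_of_dominated_convergence (fun k _ => (a k : ℝ)) ?_ ?_ ?_ ?_ ?_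
      · intro k
        exact (ContinuousMultilinearMap.apply ℂ (fun _ : Fin k => E) F
          (fun _ => y)).continuous.comp_aestronglyMeasurable (hPmeas k)
      · intro k
        refine (ae_restrict_iff' hT).2 (Eventually.of_forall fun t ht => ?_)
        refine ((P t k).le_opNorm _).trans ?_
        rw [Finset.prod_const, Finset.card_univ, Fintype.card_fin]
        refine le_trans ?_ (hPnorm t ht k)
        have : ‖y‖ ≤ r := by exact_mod_cast hy'.le
        gcongr
      · exact Eventually.of_forall fun _ => NNReal.summable_coe.2 hasum
      · exact integrable_const _
      · refine (ae_restrict_iff' hT).2 (Eventually.of_forall fun t ht => ?_)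
        have hut : ((‖u t‖₊ : NNReal) : ENNReal) < r + r + r := by
          have h0 := hunorm t ht
          have : ‖u t‖₊ < r + r + r := lt_of_le_of_lt h0 (by
            have := hr; rw [add_assoc]; exact lt_add_of_pos_right r (by positivity))
          exact_mod_cast this
        have h3 := (hH.changeOrigin hut).hasSum (y := inlE y) (by
          rw [Metric.mem_eball, edist_zero_right]
          have h4 : ‖inlE y‖ₑ = ‖y‖ₑ := by
            simp [inlE, enorm_eq_nnnorm, Prod.nnnorm_def]
          rw [h4, lt_tsub_iff_right, enorm_eq_nnnorm]
          have h0 := hunorm t ht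
          have : ‖y‖₊ + ‖u t‖₊ < r + r + r := by
            calc ‖y‖₊ + ‖u t‖₊ < r + r := add_lt_add_of_lt_of_le hy' h0
              _ ≤ r + r + r := le_self_add
          exact_mod_cast this)
        have h5 : (y₀, z₀) + u t + inlE y = (y₀ + y, γ t) := by
          simp [hu, inlE]
        rw [h5] at h3
        exact h3
    convert hlim using 2 with k
    exact (ContinuousLinearMap.integral_comp_comm
      (ContinuousMultilinearMap.apply ℂ (fun _ : Fin k => E) F (fun _ => y)) (hPint k)).symm

@[fun_prop]
lemma AnalyticAt.fst_comp {𝕜 E F G : Type*} [NontriviallyNormedField 𝕜]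
    [NormedAddCommGroup E] [NormedSpace 𝕜 E] [NormedAddCommGroup F] [NormedSpace 𝕜 F]
    [NormedAddCommGroup G] [NormedSpace 𝕜 G] {f : E → F × G} {x : E}
    (hf : AnalyticAt 𝕜 f x) : AnalyticAt 𝕜 (fun y => (f y).1) x :=
  AnalyticAt.fun_comp (g := Prod.fst) analyticAt_fst hf

@[fun_prop]
lemma AnalyticAt.snd_comp {𝕜 E F G : Type*} [NontriviallyNormedField 𝕜]
    [NormedAddCommGroup E] [NormedSpace 𝕜 E] [NormedAddCommGroup F] [NormedSpace 𝕜 F]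
    [NormedAddCommGroup G] [NormedSpace 𝕜 G] {f : E → F × G} {x : E}
    (hf : AnalyticAt 𝕜 f x) : AnalyticAt 𝕜 (fun y => (f y).2) x :=
  AnalyticAt.fun_comp (g := Prod.snd) analyticAt_snd hf

@[fun_prop]
lemma AnalyticAt.clm_apply_fun {𝕜 E F G : Type*} [NontriviallyNormedField 𝕜]
    [NormedAddCommGroup E] [NormedSpace 𝕜 E] [NormedAddCommGroup F] [NormedSpace 𝕜 F]
    [NormedAddCommGroup G] [NormedSpace 𝕜 G] {c : E → F →L[𝕜] G} {u : E → F} {x : E}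
    (hc : AnalyticAt 𝕜 c x) (hu : AnalyticAt 𝕜 u x) : AnalyticAt 𝕜 (fun y => c y (u y)) x :=
  AnalyticAt.comp₂ (h := fun p : (F →L[𝕜] G) × F => p.1 p.2)
    ((ContinuousLinearMap.id 𝕜 (F →L[𝕜] G)).analyticAt_bilinear (c x, u x)) hc hu

open Filter MeasureTheory in
/-- Integrals of analytic functions over a compact interval of parameters are analytic. -/
lemma analyticAt_intervalIntegral {E F : Type*}
    [NormedAddCommGroup E] [NormedSpace ℂ E] [NormedAddCommGroup F] [NormedSpace ℂ F]
    [CompleteSpace F] {H : E × ℂ → F} {y₀ : E} {γ : ℝ → ℂ} (hγ : Continuous γ) {a b : ℝ}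
    (hab : a ≤ b) (hH : ∀ t ∈ Icc a b, AnalyticAt ℂ H (y₀, γ t)) :
    AnalyticAt ℂ (fun y => ∫ t in a..b, H (y, γ t)) y₀ := by
  have hint : ∀ᶠ y in 𝓝 y₀, ContinuousOn (fun t => H (y, γ t)) (Icc a b) := by
    have h1 : ∀ t ∈ Icc a b, ∀ᶠ p : E × ℝ in 𝓝 (y₀, t), ContinuousAt H (p.1, γ p.2) := by
      intro t ht
      have h2 : ContinuousAt (fun p : E × ℝ => (p.1, γ p.2)) (y₀, t) := by fun_prop
      exact (h2.eventually (hH t ht).eventually_analyticAt).mono fun p hp => hp.continuousAt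
    have h3 := isCompact_Icc.eventually_forall_of_forall_eventually
      (P := fun y t => ContinuousAt H (y, γ t)) h1
    filter_upwards [h3] with y hy t ht
    exact ((hy t ht).comp (f := fun t => (y, γ t)) (by fun_prop)).continuousWithinAt
  -- Quantifying over all measurable `T` makes the property stable under unions, as compactness
  -- induction requires: `T` splits into `T ∩ S` and `T \ S`.
  have key : ∃ S : Set ℝ, MeasurableSet S ∧ Icc a b ⊆ S ∧ ∀ T ⊆ S ∩ Icc a b, MeasurableSet T →
      AnalyticAt ℂ (fun y => ∫ t in T, H (y, γ t)) y₀ := by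
    refine isCompact_Icc.induction_on (p := fun s => ∃ S : Set ℝ, MeasurableSet S ∧ s ⊆ S ∧
      ∀ T ⊆ S ∩ Icc a b, MeasurableSet T → AnalyticAt ℂ (fun y => ∫ t in T, H (y, γ t)) y₀)
      ?_ ?_ ?_ ?_
    · refine ⟨∅, MeasurableSet.empty, subset_rfl, fun T hT _ => ?_⟩
      rw [empty_inter, subset_empty_iff] at hT
      simp only [hT, Measure.restrict_empty, integral_zero_measure]
      exact analyticAt_const
    · rintro s t hst ⟨S, hS, hsS, h⟩
      exact ⟨S, hS, hst.trans hsS, h⟩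
    · rintro s t ⟨S, hS, hsS, h⟩ ⟨S', hS', hsS', h'⟩
      refine ⟨S ∪ S', hS.union hS', union_subset_union hsS hsS', fun T hT hTm => ?_⟩
      have e1 := h (T ∩ S) (fun x hx => ⟨hx.2, (hT hx.1).2⟩) (hTm.inter hS)
      have e2 := h' (T \ S) (fun x hx => ⟨(hT hx.1).1.resolve_left hx.2, (hT hx.1).2⟩)
        (hTm.diff hS)
      refine (e1.add e2).congr ?_
      filter_upwards [hint] with y hy
      have hi : IntegrableOn (fun t => H (y, γ t)) (Icc a b) := hy.integrableOn_Icc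
      exact integral_inter_add_sdiff hS (hi.mono_set fun x hx => (hT hx).2) 
    · intro t ht
      obtain ⟨q, R, hq⟩ := hH t ht
      obtain ⟨r, hr0, hrR⟩ : ∃ r : NNReal, 0 < r ∧ ((r : ENNReal) + r + r) ≤ R := by
        obtain ⟨r, hr0, hrR⟩ := ENNReal.lt_iff_exists_nnreal_btwn.1 hq.r_pos
        refine ⟨r / 3, by have : 0 < r := by exact_mod_cast hr0
                          positivity, ?_⟩
        refine le_trans (le_of_eq ?_) hrR.le
        have : r / 3 + r / 3 + r / 3 = r := by ring
        exact_mod_cast this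
      have hcont : ∀ᶠ t' in 𝓝 t, ‖γ t' - γ t‖ < r := by
        have h0 : Tendsto (fun t' => ‖γ t' - γ t‖) (𝓝 t) (𝓝 ‖γ t - γ t‖) :=
          (by fun_prop : Continuous fun t' => ‖γ t' - γ t‖).tendsto t
        refine h0.eventually_lt_const ?_
        simpa using hr0
      obtain ⟨O, hO, hOo, htO⟩ := eventually_nhds_iff.1 hcont
      refine ⟨O, mem_nhdsWithin_of_mem_nhds (hOo.mem_nhds htO), O, hOo.measurableSet, subset_rfl,
        fun T hT hTm => ?_⟩
      refine analyticAt_setIntegral_of_hasFPowerSeriesOnBall hr0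
        (hq.mono (by positivity) hrR) hγ hTm ?_ ?_
      · exact ((measure_mono (hT.trans inter_subset_right)).trans_lt
          isCompact_Icc.measure_lt_top).ne
      · intro t' ht'
        exact_mod_cast (hO t' (hT ht').1).le
  obtain ⟨S, -, hS, h⟩ := key
  have h4 := h (Ioc a b) (fun x hx => ⟨hS (Ioc_subset_Icc_self hx), Ioc_subset_Icc_self hx⟩)
    measurableSet_Ioc
  simpa only [intervalIntegral.integral_of_le hab] using h4

/-! ### Division by the first variable -/

/-- Division of an analytic function by its first variable. -/
noncomputable def divFst {E F : Type*} [NormedAddCommGroup F] [NormedSpace ℂ F]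
    (k : ℂ × E → F) (p : ℂ × E) : F :=
  dslope (fun t => k (t, p.2)) 0 p.1

/-- Hadamard's lemma: `k (τ, y) - k (0, y) = τ ∫₀¹ ∂₁k (tτ, y) dt`, and the integral is jointly
analytic in `(τ, y)`. -/
lemma analyticAt_divFst_zero {E F : Type*}
    [NormedAddCommGroup E] [NormedSpace ℂ E] [NormedAddCommGroup F] [NormedSpace ℂ F]
    [CompleteSpace F] {k : ℂ × E → F} {y₀ : E} (hk : AnalyticAt ℂ k (0, y₀)) :
    AnalyticAt ℂ (divFst k) (0, y₀) := by
  set H : (ℂ × E) × ℂ → F := fun x => fderiv ℂ k (x.2 * x.1.1, x.1.2) (1, 0) with hH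
  have hHan : ∀ t ∈ Icc (0 : ℝ) 1, AnalyticAt ℂ H (((0 : ℂ), y₀), (t : ℂ)) := by
    intro t _
    have h1 : AnalyticAt ℂ (fun x : (ℂ × E) × ℂ => ((x.2 * x.1.1, x.1.2) : ℂ × E))
        (((0 : ℂ), y₀), (t : ℂ)) := by fun_prop
    have h2 : AnalyticAt ℂ (fderiv ℂ k) ((t : ℂ) * 0, y₀) := by
      rw [mul_zero]; exact hk.fderiv
    have h3 := AnalyticAt.fun_comp (g := fderiv ℂ k)
      (f := fun x : (ℂ × E) × ℂ => ((x.2 * x.1.1, x.1.2) : ℂ × E)) h2 h1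
    exact h3.clm_apply_fun analyticAt_const
  refine (analyticAt_intervalIntegral (γ := fun t : ℝ => (t : ℂ)) (by fun_prop)
    zero_le_one hHan).congr ?_
  obtain ⟨r, hr, hkr⟩ := hk.exists_ball_analyticOnNhd
  filter_upwards [Metric.ball_mem_nhds _ hr] with p hp
  have hseg : ∀ t ∈ Icc (0 : ℝ) 1, AnalyticAt ℂ k ((t : ℂ) * p.1, p.2) := by
    intro t ht
    refine hkr _ ?_
    rw [Metric.mem_ball, Prod.dist_eq, max_lt_iff] at hp ⊢
    refine ⟨?_, hp.2⟩
    have h1 := hp.1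
    simp only [dist_zero_right, norm_mul, Complex.norm_real, Real.norm_eq_abs] at h1 ⊢
    rw [abs_of_nonneg ht.1]
    exact (mul_le_of_le_one_left (norm_nonneg _) ht.2).trans_lt h1
  have hder : ∀ t ∈ Icc (0 : ℝ) 1, HasDerivAt (fun t : ℝ => k ((t : ℂ) * p.1, p.2))
      (p.1 • H (p, (t : ℂ))) t := by
    intro t ht
    have h1 : HasDerivAt (fun t : ℝ => (((t : ℂ) * p.1, p.2) : ℂ × E)) (p.1 • ((1 : ℂ), (0 : E))) t := by
      have := ((hasDerivAt_id t).ofReal_comp.mul_const p.1).prodMk (hasDerivAt_const t p.2)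
      simpa using this
    have h2 := ((hseg t ht).differentiableAt.hasFDerivAt.restrictScalars ℝ).comp_hasDerivAt t h1
    have h3 : p.1 • H (p, (t : ℂ)) =
        fderiv ℂ k ((t : ℂ) * p.1, p.2) (p.1 • ((1 : ℂ), (0 : E))) := (map_smul _ _ _).symm
    rw [h3]
    exact h2
  have hHc : ContinuousOn (fun t : ℝ => H (p, (t : ℂ))) (Icc 0 1) := by
    intro t ht
    refine ContinuousAt.continuousWithinAt ?_
    have h1 : ContinuousAt (fun t : ℝ => fderiv ℂ k ((t : ℂ) * p.1, p.2)) t :=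
      ContinuousAt.comp (g := fderiv ℂ k) (f := fun t : ℝ => (((t : ℂ) * p.1, p.2) : ℂ × E))
        (hseg t ht).fderiv.continuousAt (by fun_prop)
    exact h1.clm_apply continuousAt_const
  by_cases hp0 : p.1 = 0
  · obtain ⟨τ, y⟩ := p
    simp only at hp0
    subst hp0
    simp only [hH, divFst, dslope_same, mul_zero]
    rw [intervalIntegral.integral_const]
    have h0 := hseg 0 (by simp)
    simp only [mul_zero] at h0
    have h1 : HasDerivAt (fun t : ℂ => ((t, y) : ℂ × E)) ((1 : ℂ), (0 : E)) 0 :=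
      (hasDerivAt_id _).prodMk (hasDerivAt_const _ _)
    have h2 := h0.differentiableAt.hasFDerivAt.comp_hasDerivAt (0 : ℂ) h1
    simpa [Function.comp_def] using h2.deriv.symm
  · have h3 := intervalIntegral.integral_eq_sub_of_hasDerivAt
      (f := fun t : ℝ => k ((t : ℂ) * p.1, p.2)) (a := 0) (b := 1)
      (fun t ht => hder t (by simpa using ht))
      ((continuousOn_const.smul hHc).intervalIntegrable_of_Icc zero_le_one)
    rw [intervalIntegral.integral_smul] at h3
    simp only [divFst]
    rw [dslope_of_ne _ hp0, slope_def_module]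
    rw [eq_comm, inv_smul_eq_iff₀ (by simpa using hp0)]
    simpa using h3.symm

lemma sub_eq_smul_divFst {E F : Type*} [NormedAddCommGroup F] [NormedSpace ℂ F]
    (k : ℂ × E → F) (t : ℂ) (y : E) : k (t, y) = k (0, y) + t • divFst k (t, y) := by
  have := sub_smul_dslope (fun t => k (t, y)) 0 t
  simp only [sub_zero] at this
  simp [divFst, this]

/-- Away from first coordinate `0` the quotient is explicit, but it involves the value `k (0, y)`;
hence the second analyticity hypothesis. -/
lemma analyticAt_divFst {E F : Type*}
    [NormedAddCommGroup E] [NormedSpace ℂ E] [NormedAddCommGroup F] [NormedSpace ℂ F]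
    [CompleteSpace F] {k : ℂ × E → F} {x : ℂ × E} (hk : AnalyticAt ℂ k x)
    (hk0 : AnalyticAt ℂ k (0, x.2)) : AnalyticAt ℂ (divFst k) x := by
  obtain ⟨t, y⟩ := x
  by_cases ht : t = 0
  · subst ht
    exact analyticAt_divFst_zero hk0
  · have h1 : AnalyticAt ℂ (fun p : ℂ × E => p.1⁻¹ • (k p - k (0, p.2))) (t, y) := by
      have h2 : AnalyticAt ℂ (fun p : ℂ × E => k (0, p.2)) (t, y) :=
        AnalyticAt.fun_comp (g := k) (f := fun p : ℂ × E => ((0 : ℂ), p.2)) hk0 (by fun_prop)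
      exact (analyticAt_fst.inv ht).smul (hk.sub h2)
    refine h1.congr ?_
    have h3 : ∀ᶠ p : ℂ × E in 𝓝 (t, y), p.1 ≠ 0 :=
      continuousAt_fst.eventually_ne ht
    filter_upwards [h3] with p hp
    rw [inv_smul_eq_iff₀ hp]
    have := sub_eq_smul_divFst k p.1 p.2
    rw [Prod.mk.eta] at this
    rw [this]; simp

/-! ### Conjugation, complexification and polarization -/

/-- The conjugate `v ↦ star (m (star v))` of a continuous complex multilinear map. -/
noncomputable def ContinuousMultilinearMap.starConj {E F : Type*}
    [NormedAddCommGroup E] [NormedSpace ℂ E] [StarAddMonoid E] [NormedStarGroup E] [StarModule ℂ E]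
    [NormedAddCommGroup F] [NormedSpace ℂ F] [StarAddMonoid F] [NormedStarGroup F] [StarModule ℂ F]
    {n : ℕ} (m : E [×n]→L[ℂ] F) : E [×n]→L[ℂ] F where
  toFun v := star (m (star ∘ v))
  map_update_add' v i x y := by
    simp [Function.comp_update]
  map_update_smul' v i c x := by
    simp [Function.comp_update]
  cont := by
    refine continuous_star.comp (m.cont.comp ?_)
    exact continuous_pi fun i => continuous_star.comp (continuous_apply i)

/-- Conjugating the coefficients of a power series does not increase their norms, so the conjugated
series still converges where the original does. -/
lemma AnalyticAt.star_conj {E F : Type*}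
    [NormedAddCommGroup E] [NormedSpace ℂ E] [StarAddMonoid E] [NormedStarGroup E] [StarModule ℂ E]
    [NormedAddCommGroup F] [NormedSpace ℂ F] [StarAddMonoid F] [NormedStarGroup F] [StarModule ℂ F]
    {f : E → F} {x : E} (hf : AnalyticAt ℂ f (star x)) :
    AnalyticAt ℂ (fun z => star (f (star z))) x := by
  obtain ⟨p, r, hp⟩ := hf
  refine ⟨fun n => (p n).starConj, r, ?_, hp.r_pos, ?_⟩
  · refine hp.r_le.trans (FormalMultilinearSeries.radius_le_of_le fun n => ?_)
    refine ContinuousMultilinearMap.opNorm_le_bound (norm_nonneg _) fun v => ?_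
    change ‖star (p n (star ∘ v))‖ ≤ _
    rw [norm_star]
    refine ((p n).le_opNorm _).trans (le_of_eq ?_)
    simp
  · intro y hy
    have h1 := hp.hasSum (y := star y) (by simpa [Metric.mem_eball, edist_zero_right, enorm_eq_nnnorm] using hy)
    have h2 := h1.star
    simp only [star_add]
    exact h2

/-- A real analytic function of finitely many real variables is the restriction of a holomorphic
function. -/
lemma exists_analyticAt_complexification {ι : Type*} [Fintype ι] {f : (ι → ℝ) → ℂ} {x₀ : ι → ℝ}
    (hf : AnalyticAt ℝ f x₀) :
    ∃ g : (ι → ℂ) → ℂ, AnalyticAt ℂ g (fun i => (x₀ i : ℂ)) ∧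
      ∀ᶠ x in 𝓝 x₀, g (fun i => (x i : ℂ)) = f x := by
  classical
  obtain ⟨p, R, hp⟩ := hf
  let pc : FormalMultilinearSeries ℂ (ι → ℂ) ℂ := fun n => ∑ j : Fin n → ι,
    p n (fun i => Pi.single (j i) 1) •
      (ContinuousMultilinearMap.mkPiAlgebraFin ℂ n ℂ).compContinuousLinearMap
        (fun i => ContinuousLinearMap.proj (j i))
  have hpc_apply : ∀ n (v : Fin n → ι → ℂ), pc n v =
      ∑ j : Fin n → ι, p n (fun i => Pi.single (j i) 1) * ∏ i, v i (j i) := by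
    intro n v
    simp [pc, List.prod_ofFn]
  have hpc_real : ∀ n (v : Fin n → ι → ℝ), pc n (fun i k => (v i k : ℂ)) = p n v := by
    intro n v
    rw [hpc_apply]
    have h1 : v = fun i => ∑ k, v i k • (Pi.single k (1 : ℝ) : ι → ℝ) := by
      funext i
      exact (pi_eq_sum_univ' (v i)).trans (by
        refine Finset.sum_congr rfl fun k _ => ?_
        congr 1)
    conv_rhs => rw [h1]
    have h2 := (p n).toMultilinearMap.map_sum (fun i k => v i k • (Pi.single k (1 : ℝ) : ι → ℝ))
    simp only [ContinuousMultilinearMap.coe_coe] at h2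
    rw [h2]
    refine Finset.sum_congr rfl fun j _ => ?_
    have h3 := (p n).map_smul_univ (fun i => v i (j i)) (fun i => (Pi.single (j i) (1 : ℝ) : ι → ℝ))
    rw [h3, Complex.real_smul]
    push_cast
    ring
  have hpc_norm : ∀ n, ‖pc n‖ ≤ (Fintype.card ι : ℝ) ^ n * ‖p n‖ := by
    intro n
    refine ContinuousMultilinearMap.opNorm_le_bound (by positivity) fun v => ?_
    rw [hpc_apply]
    refine (norm_sum_le _ _).trans ?_
    have h1 : ∀ j ∈ (Finset.univ : Finset (Fin n → ι)),
        ‖p n (fun i => Pi.single (j i) 1) * ∏ i, v i (j i)‖ ≤ ‖p n‖ * ∏ i, ‖v i‖ := by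
      intro j _
      rw [norm_mul, norm_prod]
      gcongr with i
      · refine ((p n).le_opNorm _).trans (mul_le_of_le_one_right (norm_nonneg _) ?_)
        refine Finset.prod_le_one (fun _ _ => norm_nonneg _) fun i _ => ?_
        refine (pi_norm_le_iff_of_nonneg zero_le_one).2 fun l => ?_
        rw [Pi.single_apply]
        split_ifs <;> simp
      · exact norm_le_pi_norm (v i) (j i)
    refine (Finset.sum_le_card_nsmul _ _ _ h1).trans (le_of_eq ?_)
    simp [mul_assoc]
  obtain ⟨r, hr0, hrR⟩ := ENNReal.lt_iff_exists_nnreal_btwn.1 hp.r_pos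
  have hr0' : 0 < r := by exact_mod_cast hr0
  obtain ⟨C, hC, hbd⟩ := p.norm_mul_pow_le_of_lt_radius (hrR.trans_le hp.r_le)
  -- Expanding over basis vectors costs a factor `card ι ^ n` in the norm of the `n`-th term; the `+
  -- 1` covers an empty `ι`.
  set r' : NNReal := r / (Fintype.card ι + 1) with hr'
  have hr'0 : 0 < r' := by positivity
  have hrad : (r' : ENNReal) ≤ pc.radius := by
    refine pc.le_radius_of_bound C fun n => ?_
    refine le_trans ?_ (hbd n)
    have h1 : (r' : ℝ) * Fintype.card ι ≤ r := by
      rw [hr']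
      push_cast
      rw [div_mul_eq_mul_div, div_le_iff₀ (by positivity)]
      gcongr
      simp
    calc ‖pc n‖ * (r' : ℝ) ^ n ≤ ((Fintype.card ι : ℝ) ^ n * ‖p n‖) * (r' : ℝ) ^ n := by
          gcongr; exact hpc_norm n
      _ = ‖p n‖ * ((r' : ℝ) * Fintype.card ι) ^ n := by rw [mul_pow]; ring
      _ ≤ ‖p n‖ * (r : ℝ) ^ n := by gcongr
  have hpos : 0 < pc.radius := lt_of_lt_of_le (by exact_mod_cast hr'0) hrad
  refine ⟨fun z => pc.sum (z - fun i => (x₀ i : ℂ)), ?_, ?_⟩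
  · have h1 := (pc.hasFPowerSeriesOnBall hpos).analyticAt
    refine AnalyticAt.fun_comp (g := pc.sum) ?_ (analyticAt_id.sub analyticAt_const)
    simpa using h1
  · filter_upwards [Metric.eball_mem_nhds x₀ hp.r_pos] with x hx
    have h1 := hp.hasSum (y := x - x₀) (by
      rw [Metric.mem_eball] at hx ⊢
      simpa [edist_eq_enorm_sub] using hx)
    rw [add_sub_cancel] at h1
    rw [← h1.tsum_eq, FormalMultilinearSeries.sum]
    congr 1
    funext n
    rw [← hpc_real]
    congr 1
    funext i k
    simp

/-- A real analytic function on `ℂᵏ` has a polarization `R(z, w)`, holomorphic in both variables,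
with `R(z, z̄) = r(z)`. -/
lemma exists_polarization {k : ℕ} {r : Cn k → ℝ} {x₀ : Cn k} (hr : AnalyticAt ℝ r x₀) :
    ∃ R : Cn k × Cn k → ℂ, AnalyticAt ℂ R (x₀, star x₀) ∧
      ∀ᶠ x in 𝓝 x₀, R (x, star x) = r x := by
  let L : (Fin k ⊕ Fin k → ℝ) →L[ℝ] Cn k := ContinuousLinearMap.pi fun j =>
    (Complex.ofRealCLM.comp (ContinuousLinearMap.proj (Sum.inl j)))
      + (Complex.I : ℂ) • (Complex.ofRealCLM.comp (ContinuousLinearMap.proj (Sum.inr j)))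
  let J : Cn k → (Fin k ⊕ Fin k → ℝ) := fun z => Sum.elim (fun j => (z j).re) (fun j => (z j).im)
  have hJ : Continuous J := by
    refine continuous_pi fun i => ?_
    rcases i with j | j
    · exact Complex.continuous_re.comp (continuous_apply j)
    · exact Complex.continuous_im.comp (continuous_apply j)
  have hLJ : ∀ z, L (J z) = z := by
    intro z
    funext j
    have := Complex.re_add_im (z j)
    simp only [L, J, ContinuousLinearMap.coe_pi']
    simpa [mul_comm] using this
  have hf : AnalyticAt ℝ (fun x => (r (L x) : ℂ)) (J x₀) := by
    have h1 : AnalyticAt ℝ r (L (J x₀)) := by rw [hLJ]; exact hr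
    have h2 : AnalyticAt ℝ (fun x => r (L x)) (J x₀) :=
      AnalyticAt.fun_comp (g := r) h1 (L.analyticAt _)
    exact AnalyticAt.fun_comp (g := Complex.ofRealCLM) (Complex.ofRealCLM.analyticAt _) h2
  obtain ⟨g, hg, hgf⟩ := exists_analyticAt_complexification hf
  -- Real and imaginary parts as holomorphic functions of the independent variables `z` and `w`,
  -- where `w` stands for `z̄`.
  let S : Cn k × Cn k → (Fin k ⊕ Fin k → ℂ) := fun p =>
    Sum.elim (fun j => (p.1 j + p.2 j) / 2) (fun j => (p.1 j - p.2 j) / (2 * Complex.I))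
  have hSJ : ∀ z, S (z, star z) = fun i => ((J z i : ℝ) : ℂ) := by
    intro z
    funext i
    rcases i with j | j
    · simp only [S, J, Sum.elim_inl, Pi.star_apply, Complex.star_def]
      rw [Complex.add_conj]; push_cast; ring
    · simp only [S, J, Sum.elim_inr, Pi.star_apply, Complex.star_def]
      rw [Complex.sub_conj]; push_cast
      field_simp
  have hS : AnalyticAt ℂ S (x₀, star x₀) := by
    rw [analyticAt_pi_iff]
    intro i
    have hp : ∀ j : Fin k, AnalyticAt ℂ (fun p : Cn k × Cn k => p.1 j) (x₀, star x₀) := fun j =>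
      ((ContinuousLinearMap.proj (R := ℂ) (φ := fun _ : Fin k => ℂ) j).comp
        (ContinuousLinearMap.fst ℂ (Cn k) (Cn k))).analyticAt _
    have hq : ∀ j : Fin k, AnalyticAt ℂ (fun p : Cn k × Cn k => p.2 j) (x₀, star x₀) := fun j =>
      ((ContinuousLinearMap.proj (R := ℂ) (φ := fun _ : Fin k => ℂ) j).comp
        (ContinuousLinearMap.snd ℂ (Cn k) (Cn k))).analyticAt _
    rcases i with j | j
    · exact ((hp j).add (hq j)).div_const
    · exact ((hp j).sub (hq j)).div_const
  refine ⟨fun p => g (S p), ?_, ?_⟩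
  · refine AnalyticAt.fun_comp (g := g) ?_ hS
    rw [hSJ]; exact hg
  · filter_upwards [hJ.continuousAt.eventually hgf] with x hx
    rw [hSJ, hx, hLJ]

/-! ### Implicit functions and a totally real uniqueness set -/

/-- The implicit function theorem for analytic scalar equations. -/
lemma exists_analyticAt_implicit {𝕜 : Type*} [RCLike 𝕜] {E : Type*} [NormedAddCommGroup E]
    [NormedSpace 𝕜 E] [CompleteSpace E] {H : E × 𝕜 → 𝕜} {y₀ : E} {s₀ : 𝕜}
    (hH : AnalyticAt 𝕜 H (y₀, s₀)) (hd : fderiv 𝕜 H (y₀, s₀) (0, 1) ≠ 0) :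
    ∃ S : E → 𝕜, AnalyticAt 𝕜 S y₀ ∧ S y₀ = s₀ ∧ (∀ᶠ y in 𝓝 y₀, H (y, S y) = H (y₀, s₀)) ∧
      ∀ᶠ p in 𝓝 (y₀, s₀), H p = H (y₀, s₀) → S p.1 = p.2 := by
  have cd : ContDiffAt 𝕜 ⊤ H (y₀, s₀) := hH.contDiffAt
  have hinv : (fderiv 𝕜 H (y₀, s₀) ∘L .inr 𝕜 E 𝕜).IsInvertible := by
    refine ⟨ContinuousLinearEquiv.unitsEquivAut 𝕜 (Units.mk0 _ hd), ?_⟩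
    ext
    simp
  refine ⟨cd.implicitFunction (by simp) hinv, ?_, ?_, ?_, ?_⟩
  · exact (cd.contDiffAt_implicitFunction (by simp) hinv).analyticAt
  · exact cd.implicitFunction_apply_self (by simp) hinv
  · exact cd.eventually_apply_implicitFunction (by simp) hinv
  · exact (cd.eventually_apply_eq_iff_implicitFunction (by simp) hinv).mono fun p hp h => hp.1 h

/-- A holomorphic function of `(τ, σ, s)` that vanishes for `σ = τ̄` and `s` real is zero. -/
lemma eventually_eq_zero_of_totallyReal {h : ℂ × ℂ × ℂ → ℂ} {s₀ : ℝ}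
    (hh : AnalyticAt ℂ h (0, 0, (s₀ : ℂ)))
    (hz : ∀ᶠ p : ℂ × ℝ in 𝓝 (0, s₀), h (p.1, star p.1, (p.2 : ℂ)) = 0) :
    ∀ᶠ p in 𝓝 ((0 : ℂ), (0 : ℂ), (s₀ : ℂ)), h p = 0 := by
  obtain ⟨ε, hε, hball⟩ := hh.exists_ball_analyticOnNhd
  obtain ⟨δ, hδ, hzero⟩ := Metric.eventually_nhds_iff_ball.1 hz
  have hmem : Metric.ball ((0 : ℂ), (0 : ℂ), (s₀ : ℂ)) (min ε δ / 6) ∈ 𝓝 ((0 : ℂ), (0 : ℂ), (s₀ : ℂ)) :=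
    Metric.ball_mem_nhds _ (by positivity)
  filter_upwards [hmem] with p hp
  obtain ⟨τ, σ, s⟩ := p
  set d := min ε δ with hd
  have hd0 : 0 < d := by positivity
  simp only [Metric.mem_ball, Prod.dist_eq, max_lt_iff, dist_zero_right] at hp
  obtain ⟨hτ, hσ, hs⟩ := hp
  -- The complex line `ζ ↦ (a + ζ b, ā + ζ b̄, Re s + ζ Im s)` lies in the totally real set for real
  -- `ζ` and passes through `(τ, σ, s)` at `ζ = i`. The identity theorem in `ζ` carries the
  -- vanishing over.
  set a : ℂ := (τ + star σ) / 2 with ha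
  set b : ℂ := (τ - star σ) / (2 * Complex.I) with hb
  have hna : ‖a‖ < d / 6 := by
    have : ‖τ + star σ‖ ≤ ‖τ‖ + ‖σ‖ := (norm_add_le _ _).trans (by rw [norm_star])
    rw [ha, norm_div, Complex.norm_ofNat]; linarith
  have hnb : ‖b‖ < d / 6 := by
    have : ‖τ - star σ‖ ≤ ‖τ‖ + ‖σ‖ := (norm_sub_le _ _).trans (by rw [norm_star])
    rw [hb, norm_div, norm_mul, Complex.norm_ofNat, Complex.norm_I]; linarith
  have hsa : |s.re - s₀| < d / 6 := by
    have := Complex.abs_re_le_norm (s - s₀)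
    rw [dist_eq_norm] at hs
    simp at this; linarith
  have hsb : |s.im| < d / 6 := by
    have := Complex.abs_im_le_norm (s - s₀)
    rw [dist_eq_norm] at hs
    simp at this; linarith
  let ℓ : ℂ → ℂ × ℂ × ℂ := fun ζ => (a + ζ * b, star a + ζ * star b, (s.re : ℂ) + ζ * (s.im : ℂ))
  have hℓ : ∀ ζ ∈ Metric.ball (0 : ℂ) 2, ℓ ζ ∈ Metric.ball ((0 : ℂ), (0 : ℂ), (s₀ : ℂ)) ε := by
    intro ζ hζ
    rw [mem_ball_zero_iff] at hζ
    have hdε : d ≤ ε := min_le_left _ _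
    have e1 : ∀ x y : ℂ, ‖x‖ < d / 6 → ‖y‖ < d / 6 → ‖x + ζ * y‖ < ε := by
      intro x y hx hy
      have h1 : ‖ζ * y‖ ≤ 2 * ‖y‖ := by rw [norm_mul]; gcongr
      have := norm_add_le x (ζ * y)
      linarith
    simp only [ℓ, Metric.mem_ball, Prod.dist_eq, max_lt_iff, dist_zero_right]
    refine ⟨e1 _ _ hna hnb, e1 _ _ (by rwa [norm_star]) (by rwa [norm_star]), ?_⟩
    rw [dist_eq_norm]
    have e2 : (s.re : ℂ) + ζ * (s.im : ℂ) - (s₀ : ℂ) = ((s.re - s₀ : ℝ) : ℂ) + ζ * (s.im : ℂ) := by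
      push_cast; ring
    rw [e2]
    refine e1 _ _ ?_ ?_ <;> rw [Complex.norm_real] <;> assumption
  have hcomp : AnalyticOnNhd ℂ (fun ζ => h (ℓ ζ)) (Metric.ball 0 2) := by
    intro ζ hζ
    have h1 : AnalyticAt ℂ ℓ ζ := by
      simp only [ℓ]; fun_prop
    exact AnalyticAt.fun_comp (g := h) (hball _ (hℓ ζ hζ)) h1
  have hreal : ∀ t : ℝ, |t| < 2 → h (ℓ t) = 0 := by
    intro t ht
    have hdδ : d ≤ δ := min_le_right _ _
    have h1 := hzero (a + t * b, s.re + t * s.im) (by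
      simp only [Metric.mem_ball, Prod.dist_eq, max_lt_iff, dist_zero_right]
      constructor
      · have e : ‖(t : ℂ) * b‖ ≤ 2 * ‖b‖ := by
          rw [norm_mul, Complex.norm_real, Real.norm_eq_abs]; gcongr
        have := norm_add_le a (t * b)
        linarith
      · rw [Real.dist_eq]
        have e : |t * s.im| ≤ 2 * |s.im| := by rw [abs_mul]; gcongr
        have := abs_add_le (s.re - s₀) (t * s.im)
        have e3 : s.re + t * s.im - s₀ = s.re - s₀ + t * s.im := by ring
        rw [e3]; linarith)
    simpa [ℓ] using h1
  have hfreq : ∃ᶠ ζ in 𝓝[≠] (0 : ℂ), (fun ζ => h (ℓ ζ)) ζ = 0 := by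
    have h1 : Filter.Tendsto (fun n : ℕ => ((1 / ((n : ℝ) + 1) : ℝ) : ℂ)) Filter.atTop (𝓝[≠] 0) := by
      refine tendsto_nhdsWithin_iff.2 ⟨?_, Filter.Eventually.of_forall fun n => ?_⟩
      · have := (Complex.continuous_ofReal.tendsto 0).comp
          (tendsto_one_div_add_atTop_nhds_zero_nat (𝕜 := ℝ))
        simpa [Function.comp_def] using this
      · simp only [mem_compl_iff, mem_singleton_iff, Complex.ofReal_eq_zero]
        positivity
    refine h1.frequently (Filter.Eventually.frequently (Filter.Eventually.of_forall fun n => ?_))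
    refine hreal _ ?_
    rw [abs_of_pos (by positivity)]
    have : 1 / ((n : ℝ) + 1) ≤ 1 := by
      rw [div_le_one (by positivity)]; linarith [Nat.cast_nonneg (α := ℝ) n]
    linarith
  have hall := hcomp.eqOn_zero_of_preconnected_of_frequently_eq_zero
    (convex_ball (0 : ℂ) 2).isPreconnected (z₀ := 0) (by simp) hfreq
  have hI := hall (x := Complex.I) (by simp)
  have hℓI : ℓ Complex.I = (τ, σ, s) := by
    have hb' : star b = (star τ - σ) / (-(2 * Complex.I)) := by
      rw [hb, star_div₀, star_sub, star_star, star_mul, Complex.star_def, Complex.conj_I,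
        map_ofNat]
      congr 1
      ring
    have ha' : star a = (star τ + σ) / 2 := by
      rw [ha, star_div₀, star_add, star_star]; simp
    simp only [ℓ, ha', hb', Prod.mk.injEq]
    refine ⟨?_, ?_, ?_⟩
    · rw [ha, hb]; field_simp; ring
    · field_simp; ring
    · rw [mul_comm]; exact Complex.re_add_im s
  simpa [hℓI] using hI

/-! ### Taylor coefficients in the first variable -/

/-- The `l`-th Taylor coefficient at `0` with respect to the first variable. -/
noncomputable def taylorFst {E F : Type*} [NormedAddCommGroup F] [NormedSpace ℂ F]
    (l : ℕ) (k : ℂ × E → F) (y : E) : F :=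
  (divFst^[l] k) (0, y)

lemma analyticAt_iterate_divFst {E F : Type*}
    [NormedAddCommGroup E] [NormedSpace ℂ E] [NormedAddCommGroup F] [NormedSpace ℂ F]
    [CompleteSpace F] (l : ℕ) {k : ℂ × E → F} {y : E} (hk : AnalyticAt ℂ k (0, y)) :
    AnalyticAt ℂ (divFst^[l] k) (0, y) := by
  induction l with
  | zero => exact hk
  | succ l ih =>
    rw [Function.iterate_succ_apply']
    exact analyticAt_divFst_zero ih

lemma analyticAt_taylorFst {E F : Type*}
    [NormedAddCommGroup E] [NormedSpace ℂ E] [NormedAddCommGroup F] [NormedSpace ℂ F]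
    [CompleteSpace F] (l : ℕ) {k : ℂ × E → F} {y : E} (hk : AnalyticAt ℂ k (0, y)) :
    AnalyticAt ℂ (taylorFst l k) y :=
  AnalyticAt.fun_comp (g := divFst^[l] k) (f := fun y : E => ((0 : ℂ), y))
    (analyticAt_iterate_divFst l hk) (analyticAt_const.prod analyticAt_id)

-- Existence of the limit forces the value at `t = 0` to vanish when `l > 0`, and division by `t`
-- then lowers `l` by one.
open Filter in
lemma taylorFst_eq_of_tendsto {E F : Type*}
    [NormedAddCommGroup E] [NormedSpace ℂ E] [NormedAddCommGroup F] [NormedSpace ℂ F]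
    [CompleteSpace F] (l : ℕ) {k : ℂ × E → F} {y : E} (hk : AnalyticAt ℂ k (0, y)) {c : F}
    (hc : Tendsto (fun t => (t ^ l)⁻¹ • k (t, y)) (𝓝[≠] 0) (𝓝 c)) :
    taylorFst l k y = c := by
  induction l generalizing k with
  | zero =>
    simp only [pow_zero, inv_one, one_smul] at hc
    have h1 : ContinuousAt (fun t : ℂ => k (t, y)) 0 :=
      ContinuousAt.comp (g := k) (f := fun t : ℂ => (t, y)) hk.continuousAt (by fun_prop)
    exact tendsto_nhds_unique (h1.tendsto.mono_left nhdsWithin_le_nhds) hc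
  | succ l ih =>
    have hne : ∀ᶠ t : ℂ in 𝓝[≠] 0, t ≠ 0 := self_mem_nhdsWithin
    have hpow : Tendsto (fun t : ℂ => t ^ (l + 1)) (𝓝[≠] 0) (𝓝 0) := by
      have : Tendsto (fun t : ℂ => t ^ (l + 1)) (𝓝 0) (𝓝 (0 ^ (l + 1))) :=
        (continuous_pow (l + 1)).tendsto 0
      rw [zero_pow (by omega)] at this
      exact this.mono_left nhdsWithin_le_nhds
    have h0 : k (0, y) = 0 := by
      have h1 : ContinuousAt (fun t : ℂ => k (t, y)) 0 :=
        ContinuousAt.comp (g := k) (f := fun t : ℂ => (t, y)) hk.continuousAt (by fun_prop)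
      have h2 := hpow.smul hc
      rw [zero_smul] at h2
      refine tendsto_nhds_unique (h1.tendsto.mono_left nhdsWithin_le_nhds) (h2.congr' ?_)
      filter_upwards [hne] with t ht
      rw [smul_inv_smul₀ (pow_ne_zero _ ht)]
    have h3 := ih (analyticAt_divFst_zero hk) (hc.congr' (by
      filter_upwards [hne] with t ht
      rw [sub_eq_smul_divFst k t y, h0, zero_add, smul_smul, pow_succ, mul_inv,
        inv_mul_cancel_right₀ ht]))
    rw [← h3, taylorFst, taylorFst, Function.iterate_succ_apply]

open Filter in
/-- First order perturbation of order `t ^ l` of a solution. -/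
lemma taylorFst_eq_neg_of_perturbation {E F G : Type*}
    [NormedAddCommGroup E] [NormedSpace ℂ E] [NormedAddCommGroup F] [NormedSpace ℂ F]
    [NormedAddCommGroup G] [NormedSpace ℂ G]
    [CompleteSpace F] {l : ℕ} (hl : l ≠ 0) {κ : ℂ × E → F} {y : E} (hκ : AnalyticAt ℂ κ (0, y))
    {k : G → F} {k' : G →L[ℂ] F} {x₀ b : G} (hk : HasStrictFDerivAt k k' x₀) {X X' : ℂ → G}
    (hX : Tendsto X (𝓝[≠] 0) (𝓝 x₀)) (hκk : ∀ t, κ (t, y) = k (X t))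
    (hb : Tendsto (fun t => (t ^ l)⁻¹ • (X' t - X t)) (𝓝[≠] 0) (𝓝 b))
    (h0 : ∀ᶠ t in 𝓝[≠] 0, k (X' t) = 0) :
    taylorFst l κ y = - k' b := by
  refine taylorFst_eq_of_tendsto l hκ ?_
  have hne : ∀ᶠ t : ℂ in 𝓝[≠] 0, t ≠ 0 := self_mem_nhdsWithin
  have hpow : Tendsto (fun t : ℂ => t ^ l) (𝓝[≠] 0) (𝓝 0) := by
    have : Tendsto (fun t : ℂ => t ^ l) (𝓝 0) (𝓝 (0 ^ l)) := (continuous_pow l).tendsto 0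
    rw [zero_pow hl] at this
    exact this.mono_left nhdsWithin_le_nhds
  have hX' : Tendsto X' (𝓝[≠] 0) (𝓝 x₀) := by
    have h1 := hX.add (hpow.smul hb)
    rw [zero_smul, add_zero] at h1
    refine h1.congr' ?_
    filter_upwards [hne] with t ht
    rw [smul_inv_smul₀ (pow_ne_zero _ ht)]
    abel
  -- Strict differentiability is needed because both `X t` and `X' t` move.
  have h1 := hk.isLittleO.comp_tendsto (hX'.prodMk_nhds hX)
  have h2 : (fun t => (t ^ l)⁻¹ • (k (X' t) - k (X t) - k' (X' t - X t)))
      =o[𝓝[≠] 0] fun t => (t ^ l)⁻¹ • (X' t - X t) :=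
    Asymptotics.IsBigO.smul_isLittleO (Asymptotics.isBigO_refl _ _) h1
  have h3 : Tendsto (fun t => (t ^ l)⁻¹ • (k (X' t) - k (X t) - k' (X' t - X t)))
      (𝓝[≠] 0) (𝓝 0) := by
    have h4 := h2.trans_isBigO (hb.isBigO_one ℂ)
    exact (Asymptotics.isLittleO_one_iff ℂ).1 h4
  have h5 := (h3.add (k'.continuous.continuousAt.tendsto.comp hb)).neg
  rw [zero_add] at h5
  refine h5.congr' ?_
  filter_upwards [h0] with t ht
  simp only [Function.comp_apply, map_smul, hκk, ht]
  rw [← smul_add, ← smul_neg]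
  congr 1
  abel

lemma hasStrictFDerivAt_prodMk_left {𝕜 E F : Type*} [NontriviallyNormedField 𝕜]
    [NormedAddCommGroup E] [NormedSpace 𝕜 E] [NormedAddCommGroup F] [NormedSpace 𝕜 F]
    (x : E) (y : F) :
    HasStrictFDerivAt (fun e : E => (e, y)) (ContinuousLinearMap.inl 𝕜 E F) x :=
  (hasStrictFDerivAt_id x).prodMk (hasStrictFDerivAt_const y x)

/-! ### Coefficients of the polarized equation and the Levi form -/

open Filter in
/-- Comparison of the coefficients of `τ ^ l` and of `τ ^ l σ ^ l` in a polarized equation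
`R (F(τ, σ, s), F'(σ, s)) = 0`, in the limit where these coefficients, suitably scaled, converge. -/
lemma tangent_and_levi_of_polarized_equation {E : Type*}
    [NormedAddCommGroup E] [NormedSpace ℂ E] [CompleteSpace E]
    {R : E × E → ℂ} {q q' : E} (hR : AnalyticAt ℂ R (q, q')) {l : ℕ} (hl : l ≠ 0)
    {X : ℂ × ℂ × ℂ → E} {Y : ℂ × ℂ → E} (hX : AnalyticAt ℂ X (0, 0, 0)) (hX0 : X (0, 0, 0) = q)
    (hY : AnalyticAt ℂ Y (0, 0)) (hY0 : Y (0, 0) = q')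
    {f : ℂ × ℂ × ℂ → E} {f' : ℂ × ℂ → E} {b b' : ℂ → E} {ε ε' : ℂ → ℂ} {β β' : E}
    {L : Filter ℂ} [L.NeBot] (hL : L ≤ 𝓝 0)
    (heq : ∀ᶠ s in L, ∀ᶠ p : ℂ × ℂ in 𝓝 (0, 0), R (f (p.1, p.2, s), f' (p.2, s)) = 0)
    (hf : ∀ᶠ s in L, ∀ᶠ σ in 𝓝 (0 : ℂ),
      Tendsto (fun τ => (τ ^ l)⁻¹ • (f (τ, σ, s) - X (τ, σ, s))) (𝓝[≠] 0) (𝓝 (b s)))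
    (hf' : ∀ᶠ s in L,
      Tendsto (fun σ => (σ ^ l)⁻¹ • (f' (σ, s) - Y (σ, s))) (𝓝[≠] 0) (𝓝 (b' s)))
    (hε : Tendsto ε L (𝓝 0)) (hε' : Tendsto ε' L (𝓝 0))
    (hb : Tendsto (fun s => ε s • b s) L (𝓝 β)) (hb' : Tendsto (fun s => ε' s • b' s) L (𝓝 β')) :
    fderiv ℂ R (q, q') (β, 0) = 0 ∧
      fderiv ℂ (fun y => fderiv ℂ R (q, y) (β, 0)) q' β' = 0 := by
  subst hX0 hY0
  set q := X (0, 0, 0)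
  set q' := Y (0, 0)
  -- the coefficient of `τ ^ l`
  set κ : ℂ × (ℂ × ℂ × E) → ℂ := fun p => R (X (p.1, p.2.1, p.2.2.1), p.2.2.2) with hκdef
  have hκ : AnalyticAt ℂ κ (0, 0, 0, q') := by
    refine AnalyticAt.fun_comp (g := R)
      (f := fun p : ℂ × (ℂ × ℂ × E) => (X (p.1, p.2.1, p.2.2.1), p.2.2.2)) hR ?_
    refine AnalyticAt.prod ?_ (by fun_prop)
    exact AnalyticAt.fun_comp (g := X)
      (f := fun p : ℂ × (ℂ × ℂ × E) => (p.1, p.2.1, p.2.2.1)) hX (by fun_prop)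
  -- `Θ` is `e` times the coefficient of `τ ^ l` in `R (f, y)`, with `v` standing for `e • b`.
  -- Treating `e` and `v` as independent variables keeps `Θ` analytic at `e = 0`, the limit in which
  -- `b` itself may blow up.
  set Θ : (ℂ × E) × (ℂ × ℂ × E) → ℂ := fun p =>
    p.2.2.1 * taylorFst l κ (p.1.1, p.2.1, p.1.2) +
      fderiv ℂ R (X (0, p.1.1, p.2.1), p.1.2) (p.2.2.2, 0) with hΘdef
  have hΘ : ∀ e v, AnalyticAt ℂ Θ ((0, q'), (0, e, v)) := by
    intro e v
    have h1 : AnalyticAt ℂ (fun p : (ℂ × E) × (ℂ × ℂ × E) =>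
        taylorFst l κ (p.1.1, p.2.1, p.1.2)) ((0, q'), (0, e, v)) :=
      AnalyticAt.fun_comp (g := taylorFst l κ)
        (f := fun p : (ℂ × E) × (ℂ × ℂ × E) => (p.1.1, p.2.1, p.1.2))
        (analyticAt_taylorFst l hκ) (by fun_prop)
    have h2 : AnalyticAt ℂ (fun p : (ℂ × E) × (ℂ × ℂ × E) =>
        X (0, p.1.1, p.2.1)) ((0, q'), (0, e, v)) :=
      AnalyticAt.fun_comp (g := X)
        (f := fun p : (ℂ × E) × (ℂ × ℂ × E) => ((0 : ℂ), p.1.1, p.2.1)) hX (by fun_prop)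
    have h3 : AnalyticAt ℂ (fun p : (ℂ × E) × (ℂ × ℂ × E) =>
        fderiv ℂ R (X (0, p.1.1, p.2.1), p.1.2)) ((0, q'), (0, e, v)) :=
      AnalyticAt.fun_comp (g := fderiv ℂ R)
        (f := fun p : (ℂ × E) × (ℂ × ℂ × E) => (X (0, p.1.1, p.2.1), p.1.2))
        hR.fderiv (h2.prod (by fun_prop))
    fun_prop
  have hYc : ContinuousAt Y (0, 0) := hY.continuousAt
  have hne : ∀ᶠ t : ℂ in 𝓝[≠] 0, t ≠ 0 := self_mem_nhdsWithin
  have hpow : Tendsto (fun t : ℂ => t ^ l) (𝓝[≠] 0) (𝓝 0) := by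
    have : Tendsto (fun t : ℂ => t ^ l) (𝓝 0) (𝓝 (0 ^ l)) := (continuous_pow l).tendsto 0
    rw [zero_pow hl] at this
    exact this.mono_left nhdsWithin_le_nhds
  -- the equation for the coefficient of `τ ^ l`, valid near `s = 0`
  have hsmall : ∀ᶠ s : ℂ in 𝓝 0, AnalyticAt ℂ Y (0, s) ∧
      (∀ᶠ p : ℂ × E in 𝓝 (0, Y (0, s)), AnalyticAt ℂ κ (0, p.1, s, p.2) ∧
        AnalyticAt ℂ X (0, p.1, s) ∧ AnalyticAt ℂ R (X (0, p.1, s), p.2)) := by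
    have e1 : ContinuousAt (fun s : ℂ => ((0 : ℂ), s)) 0 := by fun_prop
    have e2 : ∀ᶠ p : ℂ × ℂ × E in 𝓝 (0, 0, q'), AnalyticAt ℂ κ (0, p.1, p.2.1, p.2.2) ∧
        AnalyticAt ℂ X (0, p.1, p.2.1) ∧ AnalyticAt ℂ R (X (0, p.1, p.2.1), p.2.2) := by
      have c1 : ContinuousAt (fun p : ℂ × ℂ × E => ((0 : ℂ), p.1, p.2.1, p.2.2)) (0, 0, q') := by
        fun_prop
      have c2 : ContinuousAt (fun p : ℂ × ℂ × E => ((0 : ℂ), p.1, p.2.1)) (0, 0, q') := by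
        fun_prop
      have c3 : ContinuousAt (fun p : ℂ × ℂ × E => (X ((0 : ℂ), p.1, p.2.1), p.2.2)) (0, 0, q') :=
        (ContinuousAt.comp (g := X) (f := fun p : ℂ × ℂ × E => ((0 : ℂ), p.1, p.2.1))
          hX.continuousAt c2).prodMk (by fun_prop)
      exact (c1.eventually hκ.eventually_analyticAt).and ((c2.eventually hX.eventually_analyticAt).and
        (c3.eventually hR.eventually_analyticAt))
    have e3 : ContinuousAt (fun s : ℂ => ((0 : ℂ), s, Y (0, s))) 0 :=
      continuousAt_const.prodMk (continuousAt_id.prodMk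
        (ContinuousAt.comp (g := Y) (f := fun s : ℂ => ((0 : ℂ), s)) hYc e1))
    filter_upwards [e1.eventually hY.eventually_analyticAt,
      e3.eventually e2.eventually_nhds] with s h1 h2
    refine ⟨h1, ?_⟩
    have c4 : ContinuousAt (fun p : ℂ × E => (p.1, s, p.2)) (0, Y (0, s)) := by fun_prop
    exact c4.eventually h2
  have hYs : ∀ s, AnalyticAt ℂ Y (0, s) → Tendsto (fun σ : ℂ => Y (σ, s)) (𝓝[≠] 0) (𝓝 (Y (0, s))) := by
    intro s h
    exact (ContinuousAt.comp (g := Y) (f := fun σ : ℂ => (σ, s)) (x := 0) h.continuousAt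
      (by fun_prop)).tendsto.mono_left nhdsWithin_le_nhds
  have hstar : ∀ᶠ s in L, Tendsto (fun σ => f' (σ, s)) (𝓝[≠] 0) (𝓝 (Y (0, s))) ∧
      ∀ᶠ σ in 𝓝[≠] (0 : ℂ), Θ ((σ, f' (σ, s)), (s, ε s, ε s • b s)) = 0 := by
    filter_upwards [hL hsmall, heq, hf, hf'] with s ⟨hYan, hs⟩ heq hf hf'
    have hlim : Tendsto (fun σ => f' (σ, s)) (𝓝[≠] 0) (𝓝 (Y (0, s))) := by
      have h1 := (hYs s hYan).add (hpow.smul hf')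
      rw [zero_smul, add_zero] at h1
      refine h1.congr' ?_
      filter_upwards [hne] with t ht
      rw [smul_inv_smul₀ (pow_ne_zero _ ht)]
      abel
    refine ⟨hlim, ?_⟩
    have hpair : Tendsto (fun σ : ℂ => (σ, f' (σ, s))) (𝓝[≠] 0) (𝓝 (0, Y (0, s))) :=
      (tendsto_id.mono_left nhdsWithin_le_nhds).prodMk_nhds hlim
    have hcurry : ∀ᶠ σ in 𝓝 (0 : ℂ), ∀ᶠ τ in 𝓝 (0 : ℂ), R (f (τ, σ, s), f' (σ, s)) = 0 := by
      rw [nhds_prod_eq] at heq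
      exact (Filter.eventually_swap_iff.1 heq).curry
    filter_upwards [hpair.eventually hs, hcurry.filter_mono nhdsWithin_le_nhds,
      hf.filter_mono nhdsWithin_le_nhds] with σ ⟨hσκ, hσX, hσR⟩ hσeq hσf
    have hstrict : HasStrictFDerivAt (fun x => R (x, f' (σ, s)))
        ((fderiv ℂ R (X (0, σ, s), f' (σ, s))).comp (ContinuousLinearMap.inl ℂ E E))
        (X (0, σ, s)) :=
      HasStrictFDerivAt.comp (g := R) (f := fun x : E => (x, f' (σ, s))) (X (0, σ, s))
        hσR.hasStrictFDerivAt (hasStrictFDerivAt_prodMk_left _ _)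
    have hXt : Tendsto (fun τ => X (τ, σ, s)) (𝓝[≠] 0) (𝓝 (X (0, σ, s))) :=
      (ContinuousAt.comp (g := X) (f := fun τ : ℂ => (τ, σ, s)) (x := 0) hσX.continuousAt
        (by fun_prop)).tendsto.mono_left nhdsWithin_le_nhds
    have h1 := taylorFst_eq_neg_of_perturbation hl hσκ hstrict hXt (fun t => rfl) hσf
      (hσeq.filter_mono nhdsWithin_le_nhds)
    simp only [hΘdef, h1]
    have h2 : fderiv ℂ R (X (0, σ, s), f' (σ, s)) (ε s • b s, 0) =
        ε s * fderiv ℂ R (X (0, σ, s), f' (σ, s)) (b s, 0) := by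
      have : ((ε s • b s, 0) : E × E) = ε s • (b s, 0) := by simp
      rw [this, map_smul, smul_eq_mul]
    rw [h2]
    simp
  have hpt : Tendsto (fun s => ((((0 : ℂ), Y (0, s)), (s, ε s, ε s • b s)) :
      (ℂ × E) × (ℂ × ℂ × E))) L (𝓝 ((0, q'), (0, 0, β))) := by
    have e1 : Tendsto (fun s : ℂ => Y (0, s)) L (𝓝 q') :=
      (ContinuousAt.comp (g := Y) (f := fun s : ℂ => ((0 : ℂ), s)) (x := 0) hYc
        (by fun_prop)).tendsto.mono_left hL
    exact (tendsto_const_nhds.prodMk_nhds e1).prodMk_nhds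
      ((tendsto_id.mono_left hL).prodMk_nhds (hε.prodMk_nhds hb))
  have hΘan : ∀ᶠ s in L, AnalyticAt ℂ Θ (((0 : ℂ), Y (0, s)), (s, ε s, ε s • b s)) :=
    hpt.eventually (hΘ 0 β).eventually_analyticAt
  have hΘ0 : ∀ y v, Θ ((0, y), (0, 0, v)) = fderiv ℂ R (q, y) (v, 0) := by
    intro y v
    simp [hΘdef, q]
  -- Limits are taken in the order `σ → 0` at fixed `s`, then `s` along `L`.
  constructor
  · rw [← hΘ0]
    have h1 := (hΘ 0 β).continuousAt.tendsto.comp hpt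
    refine tendsto_nhds_unique_of_eventuallyEq h1 tendsto_const_nhds ?_
    filter_upwards [hstar, hΘan] with s ⟨hs1, hs2⟩ hs3
    have h2 : Tendsto (fun σ : ℂ => (((σ, f' (σ, s)), (s, ε s, ε s • b s)) :
        (ℂ × E) × (ℂ × ℂ × E))) (𝓝[≠] 0) (𝓝 ((0, Y (0, s)), (s, ε s, ε s • b s))) :=
      ((tendsto_id.mono_left nhdsWithin_le_nhds).prodMk_nhds hs1).prodMk_nhds tendsto_const_nhds
    exact tendsto_nhds_unique_of_eventuallyEq (hs3.continuousAt.tendsto.comp h2)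
      tendsto_const_nhds hs2
  · -- the coefficient of `σ ^ l`
    set κ₂ : ℂ × (ℂ × ℂ × E) → ℂ := fun p => Θ ((p.1, Y (p.1, p.2.1)), p.2) with hκ₂def
    have hκ₂ : AnalyticAt ℂ κ₂ (0, (0, 0, β)) := by
      refine AnalyticAt.fun_comp (g := Θ)
        (f := fun p : ℂ × (ℂ × ℂ × E) => ((p.1, Y (p.1, p.2.1)), p.2)) (hΘ 0 β) ?_
      refine AnalyticAt.prod (AnalyticAt.prod (by fun_prop) ?_) (by fun_prop)
      exact AnalyticAt.fun_comp (g := Y)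
        (f := fun p : ℂ × (ℂ × ℂ × E) => (p.1, p.2.1)) hY (by fun_prop)
    have hpt₂ : Tendsto (fun s => ((s, ε s, ε s • b s) : ℂ × ℂ × E)) L (𝓝 (0, 0, β)) :=
      (tendsto_id.mono_left hL).prodMk_nhds (hε.prodMk_nhds hb)
    have hκ₂an : ∀ᶠ s in L, AnalyticAt ℂ κ₂ (0, (s, ε s, ε s • b s)) :=
      (tendsto_const_nhds.prodMk_nhds hpt₂).eventually hκ₂.eventually_analyticAt
    -- The same perturbation argument, now in `σ`: passing from `Y` to `f'` changes the coefficient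
    -- of `σ ^ l` in `Θ` by the derivative of `Θ` along `b'`. The left side tends to `0` with `ε'`.
    have hrel : ∀ᶠ s in L, ε' s * taylorFst l κ₂ (s, ε s, ε s • b s) =
        - fderiv ℂ Θ ((0, Y (0, s)), (s, ε s, ε s • b s)) ((0, ε' s • b' s), 0) := by
      filter_upwards [hstar, hΘan, hκ₂an, hf', hL hsmall] with s ⟨hs1, hs2⟩ hs3 hs4 hs5 ⟨hs6, _⟩
      have hstrict : HasStrictFDerivAt (fun x : ℂ × E => Θ (x, (s, ε s, ε s • b s)))
          ((fderiv ℂ Θ ((0, Y (0, s)), (s, ε s, ε s • b s))).comp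
            (ContinuousLinearMap.inl ℂ (ℂ × E) (ℂ × ℂ × E))) (0, Y (0, s)) :=
        HasStrictFDerivAt.comp (g := Θ) (f := fun x : ℂ × E => (x, (s, ε s, ε s • b s)))
          (0, Y (0, s)) hs3.hasStrictFDerivAt (hasStrictFDerivAt_prodMk_left _ _)
      have hXt : Tendsto (fun σ : ℂ => (σ, Y (σ, s))) (𝓝[≠] 0) (𝓝 (0, Y (0, s))) :=
        (tendsto_id.mono_left nhdsWithin_le_nhds).prodMk_nhds (hYs s hs6)
      have h1 := taylorFst_eq_neg_of_perturbation (X' := fun σ : ℂ => (σ, f' (σ, s)))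
        (b := ((0 : ℂ), b' s)) hl hs4 hstrict hXt (fun t => rfl) (by
          have := (tendsto_const_nhds (x := (0 : ℂ))).prodMk_nhds hs5
          simpa using this) hs2
      rw [h1]
      have h2 : (((0 : ℂ), ε' s • b' s), (0 : ℂ × ℂ × E)) = ε' s • ((0, b' s), 0) := by simp
      rw [h2, map_smul]
      simp
    have hlim1 : Tendsto (fun s => ε' s * taylorFst l κ₂ (s, ε s, ε s • b s)) L
        (𝓝 (0 * taylorFst l κ₂ (0, 0, β))) :=
      hε'.mul ((analyticAt_taylorFst l hκ₂).continuousAt.tendsto.comp hpt₂)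
    have hlim2 : Tendsto (fun s => - fderiv ℂ Θ ((0, Y (0, s)), (s, ε s, ε s • b s))
        ((0, ε' s • b' s), 0)) L (𝓝 (- fderiv ℂ Θ ((0, q'), (0, 0, β)) ((0, β'), 0))) := by
      have e1 := (hΘ 0 β).fderiv.continuousAt.tendsto.comp hpt
      have e2 : Tendsto (fun s => ((((0 : ℂ), ε' s • b' s), (0 : ℂ × ℂ × E)) :
          (ℂ × E) × (ℂ × ℂ × E))) L (𝓝 ((0, β'), 0)) :=
        (tendsto_const_nhds.prodMk_nhds hb').prodMk_nhds tendsto_const_nhds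
      exact ((isBoundedBilinearMap_apply.continuous.tendsto
        (fderiv ℂ Θ ((0, q'), (0, 0, β)), ((0, β'), (0 : ℂ × ℂ × E)))).comp
          (e1.prodMk_nhds e2)).neg
    have h3 := tendsto_nhds_unique_of_eventuallyEq hlim1 hlim2 hrel
    rw [zero_mul, eq_comm, neg_eq_zero] at h3
    rw [← h3]
    have h4 : HasFDerivAt (fun y => Θ ((0, y), (0, 0, β)))
        ((fderiv ℂ Θ ((0, q'), (0, 0, β))).comp ((ContinuousLinearMap.inl ℂ (ℂ × E) (ℂ × ℂ × E)).comp
          (ContinuousLinearMap.inr ℂ ℂ E))) q' := by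
      refine HasFDerivAt.comp (g := Θ) (f := fun y : E => (((0 : ℂ), y), ((0 : ℂ), (0 : ℂ), β))) q'
        (hΘ 0 β).differentiableAt.hasFDerivAt ?_
      exact HasFDerivAt.comp (g := fun x : ℂ × E => (x, ((0 : ℂ), (0 : ℂ), β)))
        (f := fun y : E => ((0 : ℂ), y)) q'
        (hasFDerivAt_prodMk_left _ _) (hasFDerivAt_prodMk_right _ _)
    have h5 : (fun y => fderiv ℂ R (q, y) (β, 0)) = fun y => Θ ((0, y), (0, 0, β)) := by
      funext y; rw [hΘ0]
    rw [h5, h4.fderiv]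
    simp

/-- The conditions on `β` extracted from a polarization of `r` say that `β` is a complex tangent
vector on which the Levi form vanishes. -/
lemma isComplexTangent_and_leviForm_eq_zero {k : ℕ} {r : Cn k → ℝ} {q β : Cn k}
    (hr : AnalyticAt ℝ r q) {R : Cn k × Cn k → ℂ} (hR : AnalyticAt ℂ R (q, star q))
    (hRr : ∀ᶠ x in 𝓝 q, R (x, star x) = r x)
    (hβ : fderiv ℂ R (q, star q) (β, 0) = 0)
    (hβ' : fderiv ℂ (fun y => fderiv ℂ R (q, y) (β, 0)) (star q) (star β) = 0) :
    IsComplexTangent r q β ∧ leviForm r q β = 0 := by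
  -- Near `q`, `r` is `R` composed with the real linear map `x ↦ (x, x̄)`, so its real derivatives
  -- are complex derivatives of `R` along `j`.
  let j : Cn k →L[ℝ] Cn k × Cn k :=
    (ContinuousLinearMap.id ℝ (Cn k)).prod (starL' ℝ : Cn k ≃L[ℝ] Cn k).toContinuousLinearMap
  have hj : ∀ x, j x = (x, star x) := fun x => rfl
  have hjI : ∀ v : Cn k, j (Complex.I • v) =
      Complex.I • ((v, 0) : Cn k × Cn k) - Complex.I • ((0, star v) : Cn k × Cn k) := by
    intro v
    rw [hj]
    ext i
    · simp
    · simp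
  have hjs : ∀ v : Cn k, j v = ((v, 0) : Cn k × Cn k) + ((0, star v) : Cn k × Cn k) := by
    intro v
    rw [hj]; simp
  -- first derivatives
  have hfirst : ∀ᶠ x in 𝓝 q, ∀ v, ((fderiv ℝ r x v : ℝ) : ℂ) = fderiv ℂ R (j x) (j v) := by
    have h1 : ∀ᶠ x in 𝓝 q, AnalyticAt ℂ R (j x) :=
      j.continuous.continuousAt.eventually (by rw [hj]; exact hR.eventually_analyticAt)
    filter_upwards [h1, hRr.eventually_nhds, hr.eventually_analyticAt] with x h1 h2 h3 v
    have e1 : HasFDerivAt (fun x => R (j x)) (((fderiv ℂ R (j x)).restrictScalars ℝ).comp j) x :=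
      HasFDerivAt.comp (g := R) (f := j) x (h1.differentiableAt.hasFDerivAt.restrictScalars ℝ)
        j.hasFDerivAt
    have e2 : HasFDerivAt (fun x => ((r x : ℝ) : ℂ)) (Complex.ofRealCLM.comp (fderiv ℝ r x)) x :=
      Complex.ofRealCLM.hasFDerivAt.comp x h3.differentiableAt.hasFDerivAt
    have e3 := e2.congr_of_eventuallyEq (f₁ := fun x => R (j x)) h2
    have e4 := e3.unique e1
    have e5 := congrArg (fun T : Cn k →L[ℝ] ℂ => T v) e4
    simpa using e5
  have hjq : j q = (q, star q) := rfl
  have htan : IsComplexTangent r q β := by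
    have h1 := hfirst.self_of_nhds β
    have h2 := hfirst.self_of_nhds (Complex.I • β)
    rw [hjq, hjs, map_add, hβ, zero_add] at h1
    rw [hjq, hjI, map_sub, map_smul (fderiv ℂ R (q, star q)), map_smul (fderiv ℂ R (q, star q)), hβ,
      smul_zero, zero_sub, ← h1] at h2
    -- `dr(iβ) = -i dr(β)` with both derivatives real, so both are zero.
    have h3 := congrArg Complex.re h2
    have h4 := congrArg Complex.im h2
    simp at h3 h4
    exact ⟨h4, h3⟩
  refine ⟨htan, ?_⟩
  -- second derivatives
  have hsecond : ∀ v, ((fderiv ℝ (fderiv ℝ r) q v v : ℝ) : ℂ) =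
      fderiv ℂ (fderiv ℂ R) (q, star q) (j v) (j v) := by
    intro v
    have e1 : HasFDerivAt (fun x => fderiv ℂ R (j x))
        (((fderiv ℂ (fderiv ℂ R) (j q)).restrictScalars ℝ).comp j) q :=
      HasFDerivAt.comp (g := fderiv ℂ R) (f := j) q
        (hR.fderiv.differentiableAt.hasFDerivAt.restrictScalars ℝ) j.hasFDerivAt
    have e1' := ((((ContinuousLinearMap.apply ℂ ℂ (j v)).restrictScalars ℝ).hasFDerivAt
      (x := fderiv ℂ R (j q))).comp q e1)
    have e2 : HasFDerivAt (fun x => ((fderiv ℝ r x v : ℝ) : ℂ))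
        (Complex.ofRealCLM.comp ((ContinuousLinearMap.apply ℝ ℝ v).comp
          (fderiv ℝ (fderiv ℝ r) q))) q :=
      Complex.ofRealCLM.hasFDerivAt.comp q
        ((ContinuousLinearMap.apply ℝ ℝ v).hasFDerivAt.comp q
          hr.fderiv.differentiableAt.hasFDerivAt)
    have e3 := e1'.congr_of_eventuallyEq (f₁ := fun x => ((fderiv ℝ r x v : ℝ) : ℂ))
      (hfirst.mono fun x hx => hx v)
    have e4 := e2.unique e3
    have e5 := congrArg (fun T : Cn k →L[ℝ] ℂ => T v) e4
    simpa [hjq] using e5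
  have hsymm : IsSymmSndFDerivAt ℂ R (q, star q) :=
    hR.contDiffAt.isSymmSndFDerivAt (n := ⊤) le_top
  set u : Cn k × Cn k := (β, 0) with hu
  set w : Cn k × Cn k := (0, star β) with hw
  set B := fderiv ℂ (fderiv ℂ R) (q, star q) with hB
  have hBwu : B w u = 0 := by
    rw [← hβ']
    have e1 : HasFDerivAt (fun y => fderiv ℂ R (q, y)) (B.comp (ContinuousLinearMap.inr ℂ (Cn k) (Cn k)))
        (star q) :=
      HasFDerivAt.comp (g := fderiv ℂ R) (f := fun y : Cn k => (q, y)) (star q)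
        hR.fderiv.differentiableAt.hasFDerivAt (hasFDerivAt_prodMk_right _ _)
    have e2 := (ContinuousLinearMap.apply ℂ ℂ u).hasFDerivAt.comp (star q) e1
    have e3 : fderiv ℂ (fun y => fderiv ℂ R (q, y) u) (star q) = _ := e2.fderiv
    rw [e3]
    simp [hw]
  have hBuw : B u w = 0 := by
    rw [← hBwu]; exact hsymm u w
  -- In `D²r(β, β) + D²r(iβ, iβ)` the terms `B u u` and `B w w` cancel and the mixed ones, which
  -- vanish, remain.
  have h4 : ((leviForm r q β : ℝ) : ℂ) = 0 := by
    rw [leviForm]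
    push_cast
    rw [hsecond, hsecond, hjI, hjs]
    simp only [map_add, map_sub, map_smul, add_apply, sub_apply,
      smul_apply, smul_eq_mul, ← hu, ← hw, hBwu, hBuw]
    linear_combination (B u u + B w w) / 4 * Complex.I_sq
  exact_mod_cast h4

/-! ### Segre curves of a hypersurface in `ℂ²` -/

lemma fderiv_apply_snd_eq_deriv {𝕜 E F : Type*} [NontriviallyNormedField 𝕜]
    [NormedAddCommGroup E] [NormedSpace 𝕜 E] [NormedAddCommGroup F] [NormedSpace 𝕜 F]
    {H : E × 𝕜 → F} {y : E} {s : 𝕜} (hH : DifferentiableAt 𝕜 H (y, s)) {c : F}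
    (hc : HasDerivAt (fun t => H (y, t)) c s) : fderiv 𝕜 H (y, s) (0, 1) = c := by
  have h1 : HasDerivAt (fun t : 𝕜 => (y, t)) ((0 : E), (1 : 𝕜)) s :=
    (hasDerivAt_const s y).prodMk (hasDerivAt_id s)
  exact (hH.hasFDerivAt.comp_hasDerivAt s h1).unique hc

open Filter in
/-- A real hypersurface of `ℂ²` that is transverse to the second coordinate line carries a family
of Segre curves `σ ↦ (σ, W(σ, s))` of its points `(0, Z(0, 0, s))`, and of points `Z(τ, σ, s)`
on the polar curve of `(σ, W(σ, s))`, along which polarized identities can be evaluated. -/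
lemma exists_segre_family {r : ℂ × ℂ → ℝ} (hr : AnalyticAt ℝ r (0, 0)) (hr0 : r (0, 0) = 0)
    (hd : fderiv ℝ r (0, 0) (0, Complex.I) ≠ 0) :
    ∃ (Z : ℂ × ℂ × ℂ → ℂ) (W : ℂ × ℂ → ℂ), AnalyticAt ℂ Z (0, 0, 0) ∧ AnalyticAt ℂ W (0, 0) ∧
      Z (0, 0, 0) = 0 ∧ (∀ᶠ p : ℂ × ℂ in 𝓝 (0, 0), Z (0, p.1, p.2) = Z (0, 0, p.2)) ∧
      ∀ᶠ s : ℝ in 𝓝 0, W (0, s) = star (Z (0, 0, s)) ∧ (s ≠ 0 → Z (0, 0, s) ≠ 0) ∧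
        r (0, Z (0, 0, s)) = 0 ∧
        ∀ h : (ℂ × ℂ) × (ℂ × ℂ) → ℂ, AnalyticAt ℂ h ((0, Z (0, 0, s)), (0, star (Z (0, 0, s)))) →
          (∀ᶠ p : ℂ × ℂ in 𝓝 (0, Z (0, 0, s)), r p = 0 → h (p, star p) = 0) →
          ∀ᶠ p : ℂ × ℂ in 𝓝 (0, 0), h ((p.1, Z (p.1, p.2, s)), (p.2, W (p.2, s))) = 0 := by
  -- the hypersurface as a graph
  obtain ⟨φ, hφ, hφ0, hrφ⟩ : ∃ φ : ℂ × ℝ → ℝ, AnalyticAt ℝ φ (0, 0) ∧ φ (0, 0) = 0 ∧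
      ∀ᶠ p : ℂ × ℝ in 𝓝 (0, 0), r (p.1, p.2 + Complex.I * φ p) = 0 := by
    let ℓ : (ℂ × ℝ) × ℝ →L[ℝ] ℂ × ℂ :=
      ((ContinuousLinearMap.fst ℝ ℂ ℝ).comp (ContinuousLinearMap.fst ℝ (ℂ × ℝ) ℝ)).prod
        ((Complex.ofRealCLM.comp ((ContinuousLinearMap.snd ℝ ℂ ℝ).comp
          (ContinuousLinearMap.fst ℝ (ℂ × ℝ) ℝ))) +
          (Complex.I • Complex.ofRealCLM.comp (ContinuousLinearMap.snd ℝ (ℂ × ℝ) ℝ)))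
    have hℓ : ∀ p, ℓ p = (p.1.1, (p.1.2 : ℂ) + Complex.I * (p.2 : ℂ)) := fun p => by simp [ℓ]
    have hℓ0 : ℓ (((0 : ℂ), (0 : ℝ)), (0 : ℝ)) = (0, 0) := by simp [hℓ]
    have hra : AnalyticAt ℝ r (ℓ (((0 : ℂ), (0 : ℝ)), (0 : ℝ))) := by rw [hℓ0]; exact hr
    have hH : AnalyticAt ℝ (fun p => r (ℓ p)) (((0 : ℂ), (0 : ℝ)), (0 : ℝ)) :=
      AnalyticAt.fun_comp (g := r) hra (ℓ.analyticAt _)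
    have hder : HasFDerivAt (fun p => r (ℓ p)) ((fderiv ℝ r (0, 0)).comp ℓ)
        (((0 : ℂ), (0 : ℝ)), (0 : ℝ)) := by
      have := HasFDerivAt.comp (g := r) (f := ℓ) (((0 : ℂ), (0 : ℝ)), (0 : ℝ))
        hra.differentiableAt.hasFDerivAt ℓ.hasFDerivAt
      rwa [hℓ0] at this
    obtain ⟨φ, hφ, hφ0, h1, -⟩ := exists_analyticAt_implicit hH (by
      rw [hder.fderiv]
      simpa [hℓ] using hd)
    refine ⟨φ, hφ, hφ0, ?_⟩
    filter_upwards [h1] with p hp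
    rw [hℓ0, hr0, hℓ] at hp
    exact hp
  -- its complexification
  obtain ⟨Φ, hΦ, hΦφ⟩ : ∃ Φ : ℂ × ℂ × ℂ → ℂ, AnalyticAt ℂ Φ (0, 0, 0) ∧
      ∀ᶠ p : ℂ × ℝ in 𝓝 (0, 0), Φ (p.1, star p.1, (p.2 : ℂ)) = φ p := by
    let ℓ : Cn 2 →L[ℝ] ℂ × ℝ :=
      (ContinuousLinearMap.proj (R := ℝ) (φ := fun _ : Fin 2 => ℂ) 0).prod
        (Complex.reCLM.comp (ContinuousLinearMap.proj (R := ℝ) (φ := fun _ : Fin 2 => ℂ) 1))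
    have hℓ : ∀ x, ℓ x = (x 0, (x 1).re) := fun x => rfl
    have h1 : AnalyticAt ℝ (fun x => φ (ℓ x)) (0 : Cn 2) := by
      refine AnalyticAt.fun_comp (g := φ) ?_ (ℓ.analyticAt _)
      rw [map_zero]; exact hφ
    obtain ⟨R, hR, hRφ⟩ := exists_polarization h1
    have hJ : ∀ p : ℂ × ℂ × ℂ, AnalyticAt ℂ (fun p : ℂ × ℂ × ℂ =>
        (((![p.1, p.2.2] : Cn 2), (![p.2.1, p.2.2] : Cn 2)))) p := by
      intro p
      refine AnalyticAt.prod ?_ ?_ <;> rw [analyticAt_pi_iff] <;> intro i <;> fin_cases i <;>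
        simp <;> fun_prop
    refine ⟨fun p => R (![p.1, p.2.2], ![p.2.1, p.2.2]), ?_, ?_⟩
    · refine AnalyticAt.fun_comp (g := R) (f := fun p : ℂ × ℂ × ℂ =>
        (((![p.1, p.2.2] : Cn 2), (![p.2.1, p.2.2] : Cn 2)))) ?_ (hJ _)
      convert hR using 2
      · ext i; fin_cases i <;> rfl
      · ext i; fin_cases i <;> simp
    · have hc : ContinuousAt (fun p : ℂ × ℝ => (![p.1, (p.2 : ℂ)] : Cn 2)) (0, 0) := by
        refine continuousAt_pi.2 fun i => ?_
        fin_cases i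
        · exact continuousAt_fst
        · exact (Complex.continuous_ofReal.comp continuous_snd).continuousAt
      have hc0 : (![(0 : ℂ), ((0 : ℝ) : ℂ)] : Cn 2) = 0 := by
        ext i; fin_cases i <;> simp
      have hc' := hc.tendsto
      simp only [hc0] at hc'
      have h2 := hc'.eventually hRφ
      filter_upwards [h2] with p hp
      have e : star (![p.1, (p.2 : ℂ)] : Cn 2) = ![star p.1, (p.2 : ℂ)] := by
        ext i; fin_cases i <;> simp
      rw [e] at hp
      rw [hp, hℓ]
      simp
  have hΦ0 : Φ (0, 0, 0) = 0 := by
    have := hΦφ.self_of_nhds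
    simpa [hφ0] using this
  -- the derivative in the direction of the parameter is real
  obtain ⟨c, hc⟩ : ∃ c : ℝ, HasDerivAt (fun t : ℂ => Φ (0, 0, t)) (c : ℂ) 0 := by
    have h1 : AnalyticAt ℂ (fun t : ℂ => Φ (0, 0, t)) 0 :=
      AnalyticAt.fun_comp (g := Φ) (f := fun t : ℂ => ((0 : ℂ), (0 : ℂ), t)) hΦ (by fun_prop)
    have h2 : AnalyticAt ℝ (fun t : ℝ => φ (0, t)) 0 :=
      AnalyticAt.fun_comp (g := φ) (f := fun t : ℝ => ((0 : ℂ), t)) hφ (by fun_prop)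
    have h3 := h1.differentiableAt.hasDerivAt
    have h4 : HasDerivAt (fun t : ℝ => Φ (0, 0, (t : ℂ))) (deriv (fun t : ℂ => Φ (0, 0, t)) 0) 0 := by
      refine HasDerivAt.comp_ofReal (z := 0) (e := fun t : ℂ => Φ (0, 0, t)) ?_
      rw [Complex.ofReal_zero]
      exact h3
    have h5 := h2.differentiableAt.hasDerivAt.ofReal_comp
    have h6 : ∀ᶠ t : ℝ in 𝓝 0, Φ (0, 0, (t : ℂ)) = ((φ (0, t) : ℝ) : ℂ) := by
      have e : ContinuousAt (fun t : ℝ => ((0 : ℂ), t)) 0 := by fun_prop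
      filter_upwards [e.eventually hΦφ] with t ht
      simpa using ht
    have h7 := h4.unique (h5.congr_of_eventuallyEq h6)
    exact ⟨_, h7 ▸ h3⟩
  -- As `c` is real, `1 ± i c ≠ 0`: both implicit equations below are solvable without normalizing
  -- the differential of `φ`.
  have hne : ∀ x : ℂ, (x = Complex.I ∨ x = -Complex.I) → 1 + x * (c : ℂ) ≠ 0 := by
    intro x hx h
    have := congrArg Complex.re h
    rcases hx with rfl | rfl <;> simp at this
  -- the Segre curves
  obtain ⟨S, hS, hS0, hSeq, hSuniq⟩ := exists_analyticAt_implicit (𝕜 := ℂ) (E := ℂ × ℂ)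
    (H := fun p => p.2 + Complex.I * Φ (0, p.1.1, p.2) - (p.1.2 + Complex.I * Φ (0, 0, p.1.2)))
    (y₀ := (0, 0)) (s₀ := 0) (by
      have e1 : AnalyticAt ℂ (fun p : (ℂ × ℂ) × ℂ => Φ (0, p.1.1, p.2)) ((0, 0), 0) :=
        AnalyticAt.fun_comp (g := Φ) (f := fun p : (ℂ × ℂ) × ℂ => ((0 : ℂ), p.1.1, p.2)) hΦ
          (by fun_prop)
      have e2 : AnalyticAt ℂ (fun p : (ℂ × ℂ) × ℂ => Φ (0, 0, p.1.2)) ((0, 0), 0) :=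
        AnalyticAt.fun_comp (g := Φ) (f := fun p : (ℂ × ℂ) × ℂ => ((0 : ℂ), (0 : ℂ), p.1.2)) hΦ
          (by fun_prop)
      fun_prop) (by
      have e1 : AnalyticAt ℂ (fun p : (ℂ × ℂ) × ℂ => Φ (0, p.1.1, p.2)) ((0, 0), 0) :=
        AnalyticAt.fun_comp (g := Φ) (f := fun p : (ℂ × ℂ) × ℂ => ((0 : ℂ), p.1.1, p.2)) hΦ
          (by fun_prop)
      have e2 : AnalyticAt ℂ (fun p : (ℂ × ℂ) × ℂ => Φ (0, 0, p.1.2)) ((0, 0), 0) :=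
        AnalyticAt.fun_comp (g := Φ) (f := fun p : (ℂ × ℂ) × ℂ => ((0 : ℂ), (0 : ℂ), p.1.2)) hΦ
          (by fun_prop)
      rw [fderiv_apply_snd_eq_deriv (c := 1 + Complex.I * (c : ℂ)) (AnalyticAt.differentiableAt
        (by fun_prop))]
      · exact hne _ (Or.inl rfl)
      · simpa only [hΦ0] using
          ((hasDerivAt_id' (0 : ℂ)).fun_add (hc.const_mul Complex.I)).sub_const
            (0 + Complex.I * Φ (0, 0, 0)))
  simp only [hΦ0, mul_zero, add_zero, sub_zero] at hSeq hSuniq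
  -- The complexified hypersurface consists of the pairs `(τ, x + iΦ(τ, σ, x))`, `(σ, x - iΦ(τ, σ,
  -- x))`. For `τ = 0`, `S` is the parameter `x` that keeps the first point at `(0, s + iΦ(0, 0,
  -- s))`, and `W` gives the second point.
  set W : ℂ × ℂ → ℂ := fun p => S p - Complex.I * Φ (0, p.1, S p) with hWdef
  have hW : AnalyticAt ℂ W (0, 0) := by
    have e1 : AnalyticAt ℂ (fun p : ℂ × ℂ => Φ (0, p.1, S p)) (0, 0) :=
      AnalyticAt.fun_comp (g := Φ) (f := fun p : ℂ × ℂ => ((0 : ℂ), p.1, S p))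
        (by simpa [hS0] using hΦ) (by fun_prop)
    exact hS.sub (analyticAt_const.mul e1)
  have hW0 : W (0, 0) = 0 := by simp [hWdef, hS0, hΦ0]
  -- Conversely, `T` is the parameter for which the second point is `(σ, W(σ, s))`, and `Z` gives
  -- the first point.
  obtain ⟨T, hT, hT0, hTeq, hTuniq⟩ := exists_analyticAt_implicit (𝕜 := ℂ) (E := ℂ × ℂ × ℂ)
    (H := fun p => p.2 - Complex.I * Φ (p.1.1, p.1.2.1, p.2) - W p.1.2)
    (y₀ := (0, 0, 0)) (s₀ := 0) (by
      have e1 : AnalyticAt ℂ (fun p : (ℂ × ℂ × ℂ) × ℂ => Φ (p.1.1, p.1.2.1, p.2)) ((0, 0, 0), 0) :=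
        AnalyticAt.fun_comp (g := Φ) (f := fun p : (ℂ × ℂ × ℂ) × ℂ => (p.1.1, p.1.2.1, p.2)) hΦ
          (by fun_prop)
      have e2 : AnalyticAt ℂ (fun p : (ℂ × ℂ × ℂ) × ℂ => W p.1.2) ((0, 0, 0), 0) :=
        AnalyticAt.fun_comp (g := W) (f := fun p : (ℂ × ℂ × ℂ) × ℂ => p.1.2) hW (by fun_prop)
      fun_prop) (by
      have e1 : AnalyticAt ℂ (fun p : (ℂ × ℂ × ℂ) × ℂ => Φ (p.1.1, p.1.2.1, p.2)) ((0, 0, 0), 0) :=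
        AnalyticAt.fun_comp (g := Φ) (f := fun p : (ℂ × ℂ × ℂ) × ℂ => (p.1.1, p.1.2.1, p.2)) hΦ
          (by fun_prop)
      have e2 : AnalyticAt ℂ (fun p : (ℂ × ℂ × ℂ) × ℂ => W p.1.2) ((0, 0, 0), 0) :=
        AnalyticAt.fun_comp (g := W) (f := fun p : (ℂ × ℂ × ℂ) × ℂ => p.1.2) hW (by fun_prop)
      rw [fderiv_apply_snd_eq_deriv (c := 1 - Complex.I * (c : ℂ)) (AnalyticAt.differentiableAt
        (by fun_prop))]
      · have := hne _ (Or.inr rfl)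
        rwa [neg_mul, ← sub_eq_add_neg] at this
      · exact ((hasDerivAt_id' (0 : ℂ)).fun_sub (hc.const_mul Complex.I)).sub_const (W (0, 0)))
  simp only [hΦ0, hW0, mul_zero, sub_zero] at hTeq hTuniq
  set Z : ℂ × ℂ × ℂ → ℂ := fun p => T p + Complex.I * Φ (p.1, p.2.1, T p) with hZdef
  have hZ : AnalyticAt ℂ Z (0, 0, 0) := by
    have e1 : AnalyticAt ℂ (fun p : ℂ × ℂ × ℂ => Φ (p.1, p.2.1, T p)) (0, 0, 0) :=
      AnalyticAt.fun_comp (g := Φ) (f := fun p : ℂ × ℂ × ℂ => (p.1, p.2.1, T p))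
        (by simpa [hT0] using hΦ) (by fun_prop)
    exact hT.add (analyticAt_const.mul e1)
  -- At `τ = 0` uniqueness gives `T = S`; hence `Z(0, σ, s)` does not depend on `σ`.
  have hTS : ∀ᶠ p : ℂ × ℂ in 𝓝 (0, 0), T (0, p.1, p.2) = S p := by
    have e : ContinuousAt (fun p : ℂ × ℂ => (((0 : ℂ), p.1, p.2), S p)) (0, 0) :=
      ContinuousAt.prodMk (by fun_prop) hS.continuousAt
    have e' := e.tendsto
    simp only [hS0] at e'
    filter_upwards [e'.eventually hTuniq] with p hp
    exact hp (by simp [hWdef])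
  have hZS : ∀ᶠ p : ℂ × ℂ in 𝓝 (0, 0), Z (0, p.1, p.2) = p.2 + Complex.I * Φ (0, 0, p.2) := by
    filter_upwards [hTS, hSeq] with p h1 h2
    simp only [hZdef, h1]
    exact sub_eq_zero.1 h2
  have hline : ContinuousAt (fun s : ℂ => ((0 : ℂ), s)) 0 := by fun_prop
  have hZS0 : ∀ᶠ s : ℂ in 𝓝 0, Z (0, 0, s) = s + Complex.I * Φ (0, 0, s) := hline.eventually hZS
  have hSs : ∀ᶠ s : ℂ in 𝓝 0, S (0, s) = s := by
    have e : ContinuousAt (fun s : ℂ => (((0 : ℂ), s), s)) 0 := by fun_prop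
    filter_upwards [e.eventually hSuniq] with s hs
    exact hs (by simp)
  refine ⟨Z, W, hZ, hW, ?_, ?_, ?_⟩
  · simpa [hΦ0] using hZS0.self_of_nhds
  · have e : ContinuousAt (fun p : ℂ × ℂ => p.2) (0, 0) := by fun_prop
    filter_upwards [hZS, e.eventually hZS0] with p h1 h2
    rw [h1, h2]
  · have hre : Tendsto (fun s : ℝ => (s : ℂ)) (𝓝 0) (𝓝 0) := by
      simpa using Complex.continuous_ofReal.tendsto 0
    have hcr : ContinuousAt (fun s : ℝ => ((0 : ℂ), s)) 0 := by fun_prop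
    have hc3 : Tendsto (fun s : ℝ => ((0 : ℂ), (0 : ℂ), (s : ℂ))) (𝓝 0) (𝓝 (0, 0, 0)) :=
      tendsto_const_nhds.prodMk_nhds (tendsto_const_nhds.prodMk_nhds hre)
    filter_upwards [hre.eventually hZS0, hre.eventually hSs,
      hcr.eventually hΦφ.eventually_nhds, hcr.eventually hrφ.eventually_nhds,
      hre.eventually (hline.eventually hTS), hc3.eventually hΦ.eventually_analyticAt,
      hc3.eventually hT.eventually_analyticAt, hc3.eventually hTeq.eventually_nhds] with s h1 h2 h3 h4 h5 h6 h7 h8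
    have h3' : Φ (0, 0, (s : ℂ)) = φ (0, s) := by simpa using h3.self_of_nhds
    rw [h1, h3']
    have hstar : star ((s : ℂ) + Complex.I * (φ (0, s) : ℂ)) = s - Complex.I * (φ (0, s) : ℂ) := by
      simp [sub_eq_add_neg]
    refine ⟨?_, ?_, ?_, ?_⟩
    · rw [hstar]
      simp only [hWdef, h2, h3']
    · intro hs h
      have := congrArg Complex.re h
      simp at this
      exact hs this
    · exact h4.self_of_nhds
    · intro h hh hzero
      rw [hstar] at hh
      set z₀ : ℂ := (s : ℂ) + Complex.I * (φ (0, s) : ℂ) with hz₀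
      set κ : ℂ × ℂ × ℂ → ℂ := fun p => h ((p.1, p.2.2 + Complex.I * Φ p),
        (p.2.1, p.2.2 - Complex.I * Φ p)) with hκ
      have hκan : AnalyticAt ℂ κ (0, 0, (s : ℂ)) := by
        refine AnalyticAt.fun_comp (g := h) (f := fun p : ℂ × ℂ × ℂ =>
          ((p.1, p.2.2 + Complex.I * Φ p), (p.2.1, p.2.2 - Complex.I * Φ p))) ?_ (by fun_prop)
        simp only [h3']
        exact hh
      -- In these parameters the real points of the hypersurface are `σ = τ̄`, `x` real.
      have hκ0 : ∀ᶠ p in 𝓝 ((0 : ℂ), (0 : ℂ), (s : ℂ)), κ p = 0 := by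
        refine eventually_eq_zero_of_totallyReal hκan ?_
        have hg : Tendsto (fun p : ℂ × ℝ => (p.1, (p.2 : ℂ) + Complex.I * Φ (p.1, star p.1, (p.2 : ℂ))))
            (𝓝 (0, s)) (𝓝 (0, z₀)) := by
          have e0 : ContinuousAt (fun p : ℂ × ℝ => (p.2 : ℂ)) (0, s) :=
            (Complex.continuous_ofReal.comp continuous_snd).continuousAt
          have e1 : ContinuousAt (fun p : ℂ × ℝ => Φ (p.1, star p.1, (p.2 : ℂ))) (0, s) := by
            refine ContinuousAt.comp (g := Φ) (f := fun p : ℂ × ℝ => (p.1, star p.1, (p.2 : ℂ)))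
              ?_ (continuousAt_fst.prodMk (continuousAt_fst.star.prodMk e0))
            simpa using h6.continuousAt
          have e2 : ContinuousAt (fun p : ℂ × ℝ =>
              (p.1, (p.2 : ℂ) + Complex.I * Φ (p.1, star p.1, (p.2 : ℂ)))) (0, s) :=
            continuousAt_fst.prodMk (e0.add (continuousAt_const.mul e1))
          have e3 := e2.tendsto
          simpa [h3', hz₀] using e3
        filter_upwards [h3, h4, hg.eventually hzero] with p hp1 hp2 hp3
        rw [hp1] at hp3
        have hp4 := hp3 hp2
        simp only [hκ, hp1]
        rw [← hp4]
        congr 2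
        ext
        · simp
        · simp [sub_eq_add_neg]
      have hlim : Tendsto (fun p : ℂ × ℂ => (p.1, p.2, T (p.1, p.2, (s : ℂ)))) (𝓝 (0, 0))
          (𝓝 (0, 0, (s : ℂ))) := by
        have e1 : ContinuousAt (fun p : ℂ × ℂ => T (p.1, p.2, (s : ℂ))) (0, 0) :=
          ContinuousAt.comp (g := T) (f := fun p : ℂ × ℂ => (p.1, p.2, (s : ℂ)))
            h7.continuousAt (by fun_prop)
        have e2 : ContinuousAt (fun p : ℂ × ℂ => (p.1, p.2, T (p.1, p.2, (s : ℂ)))) (0, 0) := by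
          fun_prop
        have e3 := e2.tendsto
        simpa [h5, h2] using e3
      have hc2 : ContinuousAt (fun p : ℂ × ℂ => (p.1, p.2, (s : ℂ))) (0, 0) := by fun_prop
      filter_upwards [hlim.eventually hκ0, hc2.eventually h8] with p hp1 hp2
      simp only [hκ] at hp1
      rw [← hp1]
      have e : W (p.2, (s : ℂ)) = T (p.1, p.2, (s : ℂ)) -
          Complex.I * Φ (p.1, p.2, T (p.1, p.2, (s : ℂ))) := (sub_eq_zero.1 hp2).symm
      rw [e]

/-! ### Absence of poles at the base point -/

open Filter in
/-- The quotient of two holomorphic functions of one variable, the denominator of which vanishes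
at `0` at most, is holomorphic or has a pole at `0`. -/
lemma exists_analyticOnNhd_quotient_or_pole {F : Type*} [NormedAddCommGroup F] [NormedSpace ℂ F]
    {δ : ℝ} (hδ : 0 < δ) {u : ℂ → F} {w : ℂ → ℂ} (hu : AnalyticOnNhd ℂ u (Metric.ball 0 δ))
    (hw : AnalyticOnNhd ℂ w (Metric.ball 0 δ)) (hw0 : ∀ z ∈ Metric.ball (0 : ℂ) δ, z ≠ 0 → w z ≠ 0) :
    (∃ c : ℂ → F, AnalyticOnNhd ℂ c (Metric.ball 0 δ) ∧ ∀ z ∈ Metric.ball 0 δ, u z = w z • c z) ∨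
    ∃ (a : ℕ) (β : F), a ≠ 0 ∧ β ≠ 0 ∧
      Tendsto (fun z => z ^ a • (w z)⁻¹ • u z) (𝓝[≠] 0) (𝓝 β) := by
  have h0 : (0 : ℂ) ∈ Metric.ball (0 : ℂ) δ := Metric.mem_ball_self hδ
  have hball : ∀ᶠ z in 𝓝 (0 : ℂ), z ∈ Metric.ball (0 : ℂ) δ := Metric.ball_mem_nhds _ hδ
  have hne : ∀ᶠ z : ℂ in 𝓝[≠] 0, z ≠ 0 := self_mem_nhdsWithin
  -- it suffices to find the quotient near `0`
  have hglue : ∀ c₀ : ℂ → F, AnalyticAt ℂ c₀ 0 → (∀ᶠ z in 𝓝 0, u z = w z • c₀ z) →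
      ∃ c : ℂ → F, AnalyticOnNhd ℂ c (Metric.ball 0 δ) ∧
        ∀ z ∈ Metric.ball 0 δ, u z = w z • c z := by
    classical
    intro c₀ hc₀ huc
    refine ⟨fun z => if z = 0 then c₀ 0 else (w z)⁻¹ • u z, ?_, ?_⟩
    · intro z hz
      by_cases hz0 : z = 0
      · subst hz0
        refine hc₀.congr ?_
        filter_upwards [huc, hball] with z h1 h2
        split_ifs with h
        · rw [h]
        · rw [h1, inv_smul_smul₀ (hw0 z h2 h)]
      · refine (((hw z hz).inv (hw0 z hz hz0)).smul (hu z hz)).congr ?_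
        filter_upwards [isOpen_ne.mem_nhds hz0] with y hy
        rw [if_neg hy]
        rfl
    · intro z hz
      by_cases hz0 : z = 0
      · subst hz0
        simpa using huc.self_of_nhds
      · simp only [if_neg hz0]
        rw [smul_inv_smul₀ (hw0 z hz hz0)]
  by_cases hu0 : ∀ᶠ z in 𝓝 0, u z = 0
  · left
    refine hglue 0 analyticAt_const ?_
    filter_upwards [hu0] with z hz
    simp [hz]
  have hwn : ¬ ∀ᶠ z in 𝓝 0, w z = 0 := by
    intro h
    have h1 : ∀ᶠ z : ℂ in 𝓝[≠] 0, False := by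
      filter_upwards [h.filter_mono nhdsWithin_le_nhds, hball.filter_mono nhdsWithin_le_nhds, hne]
        with z h1 h2 h3
      exact hw0 z h2 h3 h1
    exact (NeBot.ne inferInstance) (eventually_false_iff_eq_bot.1 h1)
  obtain ⟨j, u₁, hu₁, hu₁0, huj⟩ := (hu 0 h0).exists_eventuallyEq_pow_smul_nonzero_iff.2 hu0
  obtain ⟨m, w₁, hw₁, hw₁0, hwm⟩ := (hw 0 h0).exists_eventuallyEq_pow_smul_nonzero_iff.2 hwn
  simp only [sub_zero, smul_eq_mul] at huj hwm
  have hw₁ne : ∀ᶠ z in 𝓝 0, w₁ z ≠ 0 := hw₁.continuousAt.eventually_ne hw₁0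
  rcases le_or_gt m j with hmj | hjm
  · left
    refine hglue (fun z => z ^ (j - m) • (w₁ z)⁻¹ • u₁ z) ?_ ?_
    · have := hw₁.inv hw₁0
      exact (analyticAt_id.pow _).smul (this.smul hu₁)
    · filter_upwards [huj, hwm, hw₁ne] with z h1 h2 h3
      rw [h1, h2, smul_smul, smul_smul]
      congr 1
      obtain ⟨d, rfl⟩ := Nat.exists_eq_add_of_le hmj
      rw [Nat.add_sub_cancel_left, pow_add]
      field_simp
  · right
    refine ⟨m - j, (w₁ 0)⁻¹ • u₁ 0, by omega, smul_ne_zero (inv_ne_zero hw₁0) hu₁0, ?_⟩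
    have h1 : Tendsto (fun z => (w₁ z)⁻¹ • u₁ z) (𝓝[≠] 0) (𝓝 ((w₁ 0)⁻¹ • u₁ 0)) :=
      ((hw₁.inv hw₁0).smul hu₁).continuousAt.tendsto.mono_left nhdsWithin_le_nhds
    refine h1.congr' ?_
    filter_upwards [huj.filter_mono nhdsWithin_le_nhds, hwm.filter_mono nhdsWithin_le_nhds, hne,
      hw₁ne.filter_mono nhdsWithin_le_nhds] with z h1 h2 h3 h4
    rw [h1, h2, smul_smul, smul_smul]
    congr 1
    obtain ⟨d, rfl⟩ := Nat.exists_eq_add_of_lt hjm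
    have : j + d + 1 - j = d + 1 := by omega
    rw [this, add_assoc, pow_add z j]
    field_simp

open Filter in
/-- The coefficients of the expansion of a meromorphic map along a transverse line have no pole at
a point of the hypersurface. -/
lemma not_pole_of_leviForm_pos {k : ℕ} {r : ℂ × ℂ → ℝ} (hr : AnalyticAt ℝ r (0, 0))
    (hr0 : r (0, 0) = 0) (hd : fderiv ℝ r (0, 0) (0, Complex.I) ≠ 0)
    {r' : Cn k → ℝ} {q : Cn k} (hr' : AnalyticAt ℝ r' q)
    (hlevi : ∀ v, v ≠ 0 → IsComplexTangent r' q v → 0 < leviForm r' q v)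
    {f A B : ℂ × ℂ → Cn k} {g : ℂ × ℂ → ℂ} (hf : ∀ᶠ z in 𝓝 (0 : ℂ), AnalyticAt ℂ f (0, z))
    (hg : ∀ᶠ z in 𝓝 (0 : ℂ), AnalyticAt ℂ g (0, z)) (hA : AnalyticAt ℂ A (0, 0))
    (hB : ∀ᶠ z in 𝓝 (0 : ℂ), AnalyticAt ℂ B (0, z))
    (hg0 : ∀ᶠ z in 𝓝[≠] (0 : ℂ), g (0, z) ≠ 0) (hA0 : A (0, 0) = q) {l : ℕ} (hl : l ≠ 0)
    (hfA : ∀ᶠ p in 𝓝 ((0 : ℂ), (0 : ℂ)), f p = g p • A p + p.1 ^ l • B p)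
    (hmap : ∀ᶠ p in 𝓝 ((0 : ℂ), (0 : ℂ)), r p = 0 → g p ≠ 0 → r' ((g p)⁻¹ • f p) = 0)
    {a : ℕ} (ha : a ≠ 0) {β : Cn k} (hβ : β ≠ 0)
    (hpole : Tendsto (fun z => z ^ a • (g (0, z))⁻¹ • B (0, z)) (𝓝[≠] 0) (𝓝 β)) : False := by
  obtain ⟨Z, W, hZ, hW, hZ0, hZσ, hsegre⟩ := exists_segre_family hr hr0 hd
  obtain ⟨R, hR, hRr⟩ := exists_polarization hr'
  set F : ℂ × ℂ → Cn k := fun p => (g p)⁻¹ • f p with hFdef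
  -- For real `s ≠ 0` near `0` the base points `(0, Z(0, 0, s))` lie on the hypersurface and avoid
  -- the possible pole.
  set L : Filter ℂ := map (fun s : ℝ => (s : ℂ)) (𝓝[≠] 0) with hLdef
  have hLne : L.NeBot := map_neBot
  have hre : Tendsto (fun s : ℝ => (s : ℂ)) (𝓝 0) (𝓝 0) := by
    simpa using Complex.continuous_ofReal.tendsto 0
  have hL : L ≤ 𝓝 0 := hre.mono_left nhdsWithin_le_nhds
  have hz : Tendsto (fun s : ℂ => Z (0, 0, s)) (𝓝 0) (𝓝 0) := by
    have h1 : ContinuousAt (fun s : ℂ => Z (0, 0, s)) 0 :=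
      ContinuousAt.comp (g := Z) (f := fun s : ℂ => ((0 : ℂ), (0 : ℂ), s)) hZ.continuousAt
        (by fun_prop)
    simpa [ContinuousAt, hZ0] using h1
  have hzL : Tendsto (fun s : ℂ => Z (0, 0, s)) L (𝓝[≠] 0) := by
    refine tendsto_nhdsWithin_iff.2 ⟨hz.mono_left hL, ?_⟩
    rw [hLdef, eventually_map]
    filter_upwards [hsegre.filter_mono nhdsWithin_le_nhds, self_mem_nhdsWithin] with s hs hs0
    exact hs.2.1 hs0
  have hW0 : ∀ᶠ s in L, W (0, s) = star (Z (0, 0, s)) := by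
    rw [hLdef, eventually_map]
    filter_upwards [hsegre.filter_mono nhdsWithin_le_nhds] with s hs using hs.1
  have hline : Tendsto (fun z : ℂ => ((0 : ℂ), z)) (𝓝 0) (𝓝 (0, 0)) := by
    have : ContinuousAt (fun z : ℂ => ((0 : ℂ), z)) 0 := by fun_prop
    exact this
  -- good base points
  have hgood : ∀ᶠ z in 𝓝[≠] (0 : ℂ), g (0, z) ≠ 0 ∧ AnalyticAt ℂ F (0, z) ∧
      F (0, z) = A (0, z) ∧ AnalyticAt ℂ R (F (0, z), star (F (0, z))) ∧
      (∀ᶠ y in 𝓝 (F (0, z)), R (y, star y) = r' y) ∧ AnalyticAt ℂ B (0, z) ∧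
      AnalyticAt ℂ g (0, z) ∧
      (∀ᶠ p in 𝓝 ((0 : ℂ), z), f p = g p • A p + p.1 ^ l • B p) ∧
      (∀ᶠ p in 𝓝 ((0 : ℂ), z), r p = 0 → g p ≠ 0 → r' (F p) = 0) := by
    have hAline : Tendsto (fun z : ℂ => A (0, z)) (𝓝 0) (𝓝 q) := by
      rw [← hA0]
      exact hA.continuousAt.tendsto.comp hline
    have hRc : Tendsto (fun y : Cn k => (y, star y)) (𝓝 q) (𝓝 (q, star q)) :=
      (continuous_id.prodMk continuous_star).tendsto q
    filter_upwards [hg0, hf.filter_mono nhdsWithin_le_nhds, hg.filter_mono nhdsWithin_le_nhds,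
      hB.filter_mono nhdsWithin_le_nhds,
      (hline.eventually hfA.eventually_nhds).filter_mono nhdsWithin_le_nhds,
      (hline.eventually hmap.eventually_nhds).filter_mono nhdsWithin_le_nhds,
      (hAline.eventually (hRc.eventually hR.eventually_analyticAt)).filter_mono nhdsWithin_le_nhds,
      (hAline.eventually hRr.eventually_nhds).filter_mono nhdsWithin_le_nhds]
      with z h1 h2 h3 h4 h5 h6 h7 h8
    have hFA : F (0, z) = A (0, z) := by
      have := h5.self_of_nhds
      simp only [zero_pow hl, zero_smul, add_zero] at this
      simp only [hFdef, this]
      rw [inv_smul_smul₀ h1]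
    rw [hFA]
    exact ⟨h1, (h3.inv h1).smul h2, rfl, h7, h8, h4, h3, h5, h6⟩
  -- the remainder of order `l`
  have hrem : ∀ z : ℂ, g (0, z) ≠ 0 → AnalyticAt ℂ B (0, z) → AnalyticAt ℂ g (0, z) →
      (∀ᶠ p in 𝓝 ((0 : ℂ), z), f p = g p • A p + p.1 ^ l • B p) →
      ∀ γ : ℂ → ℂ, Tendsto γ (𝓝 0) (𝓝 z) →
      Tendsto (fun τ => (τ ^ l)⁻¹ • (F (τ, γ τ) - A (τ, γ τ))) (𝓝[≠] 0)
        (𝓝 ((g (0, z))⁻¹ • B (0, z))) := by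
    intro z h1 h2 h3 h4 γ hγ
    have hpair : Tendsto (fun τ : ℂ => (τ, γ τ)) (𝓝[≠] 0) (𝓝 (0, z)) :=
      (tendsto_id.prodMk_nhds hγ).mono_left nhdsWithin_le_nhds
    have h5 := ((h3.inv h1).smul h2).continuousAt.tendsto.comp hpair
    refine h5.congr' ?_
    have hne : ∀ᶠ t : ℂ in 𝓝[≠] 0, t ≠ 0 := self_mem_nhdsWithin
    filter_upwards [hpair.eventually h4, hpair.eventually (h3.continuousAt.eventually_ne h1), hne]
      with τ e1 e2 e3
    simp only [hFdef, e1, Function.comp_apply, smul_add, inv_smul_smul₀ e2, add_sub_cancel_left]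
    rw [smul_comm, inv_smul_smul₀ (pow_ne_zero l e3)]
    rfl
  have hXan : AnalyticAt ℂ (fun p : ℂ × ℂ × ℂ => A (p.1, Z p)) (0, 0, 0) := by
    refine AnalyticAt.fun_comp (g := A) (f := fun p : ℂ × ℂ × ℂ => (p.1, Z p)) ?_ (by fun_prop)
    simpa [hZ0] using hA
  have hW00 : W (0, 0) = 0 := by
    have h1 : Tendsto (fun s : ℂ => W (0, s)) L (𝓝 (W (0, 0))) :=
      (hW.continuousAt.tendsto.comp hline).mono_left hL
    have h2 : Tendsto (fun s : ℂ => star (Z (0, 0, s))) L (𝓝 (star 0)) :=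
      (continuous_star.tendsto _).comp (hz.mono_left hL)
    rw [star_zero] at h2
    exact tendsto_nhds_unique_of_eventuallyEq h1 h2 hW0
  have hst0 : star ((0 : ℂ), (0 : ℂ)) = (0, 0) := star_zero _
  have hYan : AnalyticAt ℂ (fun p : ℂ × ℂ => star (A (star (p.1, W p)))) (0, 0) := by
    refine AnalyticAt.fun_comp (g := fun x : ℂ × ℂ => star (A (star x)))
      (f := fun p : ℂ × ℂ => (p.1, W p)) ?_ (by fun_prop)
    refine AnalyticAt.star_conj ?_
    simpa only [hW00, hst0] using hA
  -- `X` and `Y` come from the holomorphic part `A`; `F` deviates from it by `b` at order `l`. The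
  -- scaling `ε = z ^ a`, with `z = Z(0, 0, s)`, is what turns the polar behaviour of `b` into the
  -- limit `β`.
  have key := tangent_and_levi_of_polarized_equation hR hl
    (X := fun p : ℂ × ℂ × ℂ => A (p.1, Z p)) (Y := fun p : ℂ × ℂ => star (A (star (p.1, W p))))
    (f := fun p : ℂ × ℂ × ℂ => F (p.1, Z p)) (f' := fun p : ℂ × ℂ => star (F (star (p.1, W p))))
    (b := fun s => (g (0, Z (0, 0, s)))⁻¹ • B (0, Z (0, 0, s)))
    (b' := fun s => star ((g (0, Z (0, 0, s)))⁻¹ • B (0, Z (0, 0, s))))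
    (ε := fun s => Z (0, 0, s) ^ a) (ε' := fun s => star (Z (0, 0, s) ^ a))
    (β := β) (β' := star β) (L := L) hXan (by simp [hZ0, hA0]) hYan (by simp only [hW00, hst0, hA0]) hL
    ?_ ?_ ?_ ?_ ?_ ?_ ?_
  · obtain ⟨h1, h2⟩ := isComplexTangent_and_leviForm_eq_zero hr' hR hRr key.1 key.2
    exact (hlevi β hβ h1).ne' h2
  · -- the polarized equation
    have hgood' := hzL.eventually hgood
    rw [hLdef, eventually_map] at hgood' ⊢
    filter_upwards [hgood', hsegre.filter_mono nhdsWithin_le_nhds] with s hs hs'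
    obtain ⟨h1, h2, -, h3, h4, -, h5, -, h6⟩ := hs
    obtain ⟨-, -, -, hs2⟩ := hs'
    have hst1 : star ((0 : ℂ), star (Z (0, 0, (s : ℂ)))) = (0, Z (0, 0, (s : ℂ))) :=
      Prod.ext (star_zero _) (star_star _)
    refine hs2 (fun x => R (F x.1, star (F (star x.2)))) ?_ ?_
    · refine AnalyticAt.fun_comp (g := R)
        (f := fun x : (ℂ × ℂ) × (ℂ × ℂ) => (F x.1, star (F (star x.2)))) (by simpa only [hst1] using h3) ?_
      refine AnalyticAt.prod ?_ ?_
      · exact AnalyticAt.fun_comp (g := F) (f := fun x : (ℂ × ℂ) × (ℂ × ℂ) => x.1) h2 (by fun_prop)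
      · refine AnalyticAt.fun_comp (g := fun y : ℂ × ℂ => star (F (star y)))
          (f := fun x : (ℂ × ℂ) × (ℂ × ℂ) => x.2) ?_ (by fun_prop)
        refine AnalyticAt.star_conj ?_
        simpa only [hst1] using h2
    · filter_upwards [h6, h5.continuousAt.eventually_ne h1, h2.continuousAt.eventually h4]
        with p e1 e2 e3 e4
      rw [star_star, e3, e1 e4 e2, Complex.ofReal_zero]
  · -- the coefficient of `τ ^ l`
    have hZev : ∀ᶠ s in L, ∀ᶠ σ in 𝓝 (0 : ℂ), AnalyticAt ℂ Z (0, σ, s) ∧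
        Z (0, σ, s) = Z (0, 0, s) := by
      have e1 : Tendsto (fun p : ℂ × ℂ => ((0 : ℂ), p.1, p.2)) (𝓝 (0, 0)) (𝓝 (0, 0, 0)) := by
        have : ContinuousAt (fun p : ℂ × ℂ => ((0 : ℂ), p.1, p.2)) (0, 0) := by fun_prop
        exact this
      have e2 := (e1.eventually hZ.eventually_analyticAt).and hZσ
      rw [nhds_prod_eq] at e2
      exact hL (eventually_swap_iff.1 e2).curry
    filter_upwards [hzL.eventually hgood, hZev] with s hs hs'
    obtain ⟨h1, -, -, -, -, h2, h3, h4, -⟩ := hs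
    filter_upwards [hs'] with σ hσ
    refine hrem (Z (0, 0, s)) h1 h2 h3 h4 (fun τ => Z (τ, σ, s)) ?_
    -- The base point is the same for all `σ`, so the limit `b s` depends on `s` only.
    rw [← hσ.2]
    exact ContinuousAt.comp (g := Z) (f := fun τ : ℂ => (τ, σ, s)) (x := 0) hσ.1.continuousAt
      (by fun_prop)
  · -- the coefficient of `σ ^ l`
    filter_upwards [hzL.eventually hgood, hW0, hL (hline.eventually hW.eventually_analyticAt)]
      with s hs hs' hs''
    obtain ⟨h1, -, -, -, -, h2, h3, h4, -⟩ := hs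
    have hγ : Tendsto (fun t : ℂ => star (W (star t, s))) (𝓝 0) (𝓝 (Z (0, 0, s))) := by
      have e1 : ContinuousAt (fun t : ℂ => W (star t, s)) 0 :=
        ContinuousAt.comp (g := W) (f := fun t : ℂ => (star t, s)) (by simpa using hs''.continuousAt)
          (by fun_prop)
      have e2 := (continuous_star.tendsto _).comp e1.tendsto
      simpa [Function.comp_def, hs'] using e2
    have e3 := hrem (Z (0, 0, s)) h1 h2 h3 h4 _ hγ
    have hst : Tendsto (fun t : ℂ => star t) (𝓝[≠] 0) (𝓝[≠] 0) := by
      refine tendsto_nhdsWithin_iff.2 ⟨?_, ?_⟩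
      · have := (continuous_star (R := ℂ)).tendsto 0
        rw [star_zero] at this
        exact this.mono_left nhdsWithin_le_nhds
      · filter_upwards [self_mem_nhdsWithin] with t ht
        simpa using ht
    have e4 := (continuous_star.tendsto _).comp (e3.comp hst)
    refine e4.congr fun σ => ?_
    simp only [Function.comp_apply, star_smul, star_sub, star_inv₀, star_pow, star_star]
    rfl
  · have := (hz.mono_left hL).pow a
    rwa [zero_pow ha] at this
  · have := (continuous_star.tendsto _).comp ((hz.mono_left hL).pow a)
    rw [zero_pow ha, star_zero] at this
    exact this
  · exact hpole.comp hzL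
  · have := (continuous_star.tendsto _).comp (hpole.comp hzL)
    refine this.congr fun s => ?_
    simp only [Function.comp_apply, star_smul]

/-- A smooth real analytic hypersurface meets a transverse complex line in a set that accumulates
at the base point. -/
lemma neBot_nhdsWithin_transverse_line {r : ℂ × ℂ → ℝ} (hr : AnalyticAt ℝ r (0, 0))
    (hr0 : r (0, 0) = 0) (hd : fderiv ℝ r (0, 0) (0, Complex.I) ≠ 0) :
    (𝓝[{z : ℂ | z ≠ 0 ∧ r (0, z) = 0}] (0 : ℂ)).NeBot := by
  obtain ⟨Z, W, hZ, -, hZ0, -, hsegre⟩ := exists_segre_family hr hr0 hd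
  have h1 : ContinuousAt (fun s : ℝ => Z (0, 0, (s : ℂ))) 0 := by
    refine ContinuousAt.comp (g := Z) (f := fun s : ℝ => ((0 : ℂ), (0 : ℂ), (s : ℂ))) ?_ ?_
    · simpa using hZ.continuousAt
    · exact (continuous_const.prodMk
        (continuous_const.prodMk Complex.continuous_ofReal)).continuousAt
  have h2 : Filter.Tendsto (fun s : ℝ => Z (0, 0, (s : ℂ))) (𝓝[≠] 0)
      (𝓝[{z : ℂ | z ≠ 0 ∧ r (0, z) = 0}] (0 : ℂ)) := by
    refine tendsto_nhdsWithin_iff.2 ⟨?_, ?_⟩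
    · have := h1.tendsto.mono_left (nhdsWithin_le_nhds (s := {0}ᶜ))
      simpa [hZ0] using this
    · filter_upwards [hsegre.filter_mono nhdsWithin_le_nhds, self_mem_nhdsWithin] with s hs hs0
      exact ⟨hs.2.1 hs0, hs.2.2.1⟩
  exact h2.neBot

/-! ### Expansion of every order along a transverse line -/

/-- Division with remainder by a power of the first variable, raised by one step. -/
lemma exists_analyticOnNhd_eq_smul_add_smul {F : Type*} [NormedAddCommGroup F] [NormedSpace ℂ F]
    [CompleteSpace F] {ρ δ : ℝ} (hρ : 0 < ρ) {B : ℂ × ℂ → F} {g : ℂ × ℂ → ℂ} {c : ℂ → F}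
    (hB : AnalyticOnNhd ℂ B (Metric.ball 0 ρ ×ˢ Metric.ball 0 δ))
    (hg : AnalyticOnNhd ℂ g (Metric.ball 0 ρ ×ˢ Metric.ball 0 δ))
    (hc : AnalyticOnNhd ℂ c (Metric.ball 0 δ))
    (h : ∀ z ∈ Metric.ball 0 δ, B (0, z) = g (0, z) • c z) :
    ∃ B' : ℂ × ℂ → F, AnalyticOnNhd ℂ B' (Metric.ball 0 ρ ×ˢ Metric.ball 0 δ) ∧
      ∀ p ∈ Metric.ball 0 ρ ×ˢ Metric.ball 0 δ, B p = g p • c p.2 + p.1 • B' p := by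
  have h0 : (0 : ℂ) ∈ Metric.ball (0 : ℂ) ρ := Metric.mem_ball_self hρ
  set k : ℂ × ℂ → F := fun p => B p - g p • c p.2 with hk
  have hka : AnalyticOnNhd ℂ k (Metric.ball 0 ρ ×ˢ Metric.ball 0 δ) := by
    intro p hp
    exact (hB p hp).fun_sub ((hg p hp).smul ((hc p.2 hp.2).fun_comp analyticAt_snd))
  refine ⟨divFst k, fun p hp => analyticAt_divFst (hka p hp) (hka (0, p.2) ⟨h0, hp.2⟩),
    fun p hp => ?_⟩
  have h1 := sub_eq_smul_divFst k p.1 p.2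
  simp only [hk, h p.2 hp.2, sub_self, zero_add] at h1
  exact (sub_eq_iff_eq_add'.1 h1)

open Filter in
/-- A meromorphic map of the bidisc that maps a real hypersurface into a strongly pseudoconvex one
has a holomorphic expansion of any order along a line transverse to the hypersurface. -/
lemma exists_analyticOnNhd_expansion {k : ℕ} {ρ δ : ℝ} (hρ : 0 < ρ) (hδ : 0 < δ)
    {r : ℂ × ℂ → ℝ} (hr : AnalyticAt ℝ r (0, 0))
    (hr0 : r (0, 0) = 0) (hd : fderiv ℝ r (0, 0) (0, Complex.I) ≠ 0)
    {r' : Cn k → ℝ} {q : Cn k} (hr' : AnalyticAt ℝ r' q)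
    (hlevi : ∀ v, v ≠ 0 → IsComplexTangent r' q v → 0 < leviForm r' q v)
    {f : ℂ × ℂ → Cn k} {g : ℂ × ℂ → ℂ}
    (hf : AnalyticOnNhd ℂ f (Metric.ball 0 ρ ×ˢ Metric.ball 0 δ))
    (hg : AnalyticOnNhd ℂ g (Metric.ball 0 ρ ×ˢ Metric.ball 0 δ))
    (hg0 : ∀ z ∈ Metric.ball (0 : ℂ) δ, z ≠ 0 → g (0, z) ≠ 0)
    (hmap : ∀ᶠ p in 𝓝 ((0 : ℂ), (0 : ℂ)), r p = 0 → g p ≠ 0 → r' ((g p)⁻¹ • f p) = 0)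
    (hlim : Tendsto (fun p => (g p)⁻¹ • f p) (𝓝[{p | r p = 0 ∧ g p ≠ 0}] (0, 0)) (𝓝 q))
    {l : ℕ} (hl : l ≠ 0) :
    ∃ A B : ℂ × ℂ → Cn k, AnalyticOnNhd ℂ A (Metric.ball 0 ρ ×ˢ Metric.ball 0 δ) ∧
      AnalyticOnNhd ℂ B (Metric.ball 0 ρ ×ˢ Metric.ball 0 δ) ∧ A (0, 0) = q ∧
      ∀ p ∈ Metric.ball 0 ρ ×ˢ Metric.ball 0 δ, f p = g p • A p + p.1 ^ l • B p := by
  have h0 : (0 : ℂ) ∈ Metric.ball (0 : ℂ) ρ := Metric.mem_ball_self hρ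
  have h0' : (0 : ℂ) ∈ Metric.ball (0 : ℂ) δ := Metric.mem_ball_self hδ
  have hD : Metric.ball (0 : ℂ) ρ ×ˢ Metric.ball (0 : ℂ) δ ∈ 𝓝 ((0 : ℂ), (0 : ℂ)) :=
    prod_mem_nhds (Metric.ball_mem_nhds _ hρ) (Metric.ball_mem_nhds _ hδ)
  have hline : ∀ {E : Type} [NormedAddCommGroup E] [NormedSpace ℂ E] {h : ℂ × ℂ → E},
      AnalyticOnNhd ℂ h (Metric.ball 0 ρ ×ˢ Metric.ball 0 δ) →
      AnalyticOnNhd ℂ (fun z => h (0, z)) (Metric.ball 0 δ) := by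
    intro E _ _ h hh z hz
    exact AnalyticAt.fun_comp (g := h) (f := fun z : ℂ => ((0 : ℂ), z)) (hh _ ⟨h0, hz⟩)
      (by fun_prop)
  have hev : ∀ {E : Type} [NormedAddCommGroup E] [NormedSpace ℂ E] {h : ℂ × ℂ → E},
      AnalyticOnNhd ℂ h (Metric.ball 0 ρ ×ˢ Metric.ball 0 δ) →
      ∀ᶠ z in 𝓝 (0 : ℂ), AnalyticAt ℂ h (0, z) := by
    intro E _ _ h hh
    filter_upwards [Metric.ball_mem_nhds (0 : ℂ) hδ] with z hz using hh _ ⟨h0, hz⟩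
  have hball : ∀ᶠ z in 𝓝 (0 : ℂ), z ∈ Metric.ball (0 : ℂ) δ := Metric.ball_mem_nhds _ hδ
  have hg0' : ∀ᶠ z in 𝓝[≠] (0 : ℂ), g (0, z) ≠ 0 := by
    filter_upwards [hball.filter_mono nhdsWithin_le_nhds, self_mem_nhdsWithin] with z h1 h2
    exact hg0 z h1 h2
  -- The bidisc stays the same for all `l`, since the Cauchy integral over one fixed circle is to be
  -- compared with expansions of every order.
  induction l with
  | zero => exact absurd rfl hl
  | succ l ih =>
    -- Order one is special: there is no `A` yet. A pole of `F` on the line would contradict `F → q`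
    -- along the points of the hypersurface in the line, where `z ^ a F` would tend both to `0` and
    -- to `β`.
    rcases eq_or_ne l 0 with rfl | hl0
    · have := neBot_nhdsWithin_transverse_line hr hr0 hd
      set L := 𝓝[{z : ℂ | z ≠ 0 ∧ r (0, z) = 0}] (0 : ℂ) with hLdef
      have hL : L ≤ 𝓝[≠] 0 := nhdsWithin_mono _ fun z hz => hz.1
      have hlimL : Tendsto (fun z => (g (0, z))⁻¹ • f (0, z)) L (𝓝 q) := by
        refine hlim.comp (tendsto_nhdsWithin_iff.2 ⟨?_, ?_⟩)
        · have h1 : ContinuousAt (fun z : ℂ => ((0 : ℂ), z)) 0 := by fun_prop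
          exact h1.tendsto.mono_left nhdsWithin_le_nhds
        · filter_upwards [hL hg0', self_mem_nhdsWithin] with z h1 h2 using ⟨h2.2, h1⟩
      rcases exists_analyticOnNhd_quotient_or_pole hδ (hline hf) (hline hg) hg0 with
        ⟨c, hc, hfc⟩ | ⟨a, β, ha, hβ, hpole⟩
      · obtain ⟨B, hB, hfB⟩ := exists_analyticOnNhd_eq_smul_add_smul hρ hf hg hc hfc
        refine ⟨fun p => c p.2, B, fun p hp => (hc p.2 hp.2).fun_comp analyticAt_snd, hB, ?_, fun p hp => ?_⟩
        · have h1 : Tendsto c L (𝓝 (c 0)) :=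
            (hc 0 h0').continuousAt.tendsto.mono_left nhdsWithin_le_nhds
          refine tendsto_nhds_unique h1 (hlimL.congr' ?_)
          filter_upwards [hL hg0', hball.filter_mono nhdsWithin_le_nhds] with z e1 e2
          rw [hfc z e2, inv_smul_smul₀ e1]
        · simpa using hfB p hp
      · exfalso
        have h1 : Tendsto (fun z : ℂ => z ^ a) L (𝓝 0) := by
          have h2 : Tendsto (fun z : ℂ => z ^ a) (𝓝 0) (𝓝 0) := by
            simpa [zero_pow ha] using (continuous_pow a).tendsto (0 : ℂ)
          exact h2.mono_left nhdsWithin_le_nhds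
        have h2 := h1.smul hlimL
        rw [zero_smul] at h2
        exact hβ (tendsto_nhds_unique (hpole.mono_left hL) h2)
    -- `B (0, ζ) / g (0, ζ)` is the coefficient of `t ^ l` in `F - A`; once it has no pole it is
    -- absorbed into `A`.
    · obtain ⟨A, B, hA, hB, hA0, hfA⟩ := ih hl0
      rcases exists_analyticOnNhd_quotient_or_pole hδ (hline hB) (hline hg) hg0 with
        ⟨c, hc, hBc⟩ | ⟨a, β, ha, hβ, hpole⟩
      · obtain ⟨B', hB', hBB'⟩ := exists_analyticOnNhd_eq_smul_add_smul hρ hB hg hc hBc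
        refine ⟨fun p => A p + p.1 ^ l • c p.2, B', fun p hp => ?_, hB', ?_, fun p hp => ?_⟩
        · exact (hA p hp).fun_add
            ((analyticAt_fst.pow l).smul ((hc p.2 hp.2).fun_comp analyticAt_snd))
        · simp [hA0, hl0]
        · rw [hfA p hp, hBB' p hp, smul_add, smul_add, smul_smul, smul_smul, smul_smul, pow_succ,
            mul_comm (g p), add_assoc]
      · exfalso
        refine not_pole_of_leviForm_pos hr hr0 hd hr' hlevi (hev hf) (hev hg) (hA _ ⟨h0, h0'⟩)
          (hev hB) hg0' hA0 hl0 ?_ hmap ha hβ hpole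
        filter_upwards [hD] with p hp using hfA p hp

/-! ### Reproduction by Cauchy integrals -/

/-- A circle integral depends analytically on a parameter. -/
lemma analyticAt_circleIntegral {E F : Type*} [NormedAddCommGroup E] [NormedSpace ℂ E]
    [NormedAddCommGroup F] [NormedSpace ℂ F] [CompleteSpace F] {h : E × ℂ → F} {y₀ : E} {c : ℂ}
    {R : ℝ} (hR : 0 ≤ R) (hh : ∀ ζ ∈ Metric.sphere c R, AnalyticAt ℂ h (y₀, ζ)) :
    AnalyticAt ℂ (fun y => ∮ ζ in C(c, R), h (y, ζ)) y₀ := by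
  have h1 := analyticAt_intervalIntegral (H := fun x : E × ℂ => ((x.2 - c) * Complex.I) • h x)
    (y₀ := y₀) (γ := circleMap c R) (continuous_circleMap c R) Real.two_pi_pos.le
    (fun t _ => ((analyticAt_snd.fun_sub analyticAt_const).fun_mul analyticAt_const).fun_smul
      (hh _ (circleMap_mem_sphere c hR t)))
  refine h1.congr (Filter.Eventually.of_forall fun y => ?_)
  simp only [circleIntegral, deriv_circleMap, circleMap_sub_center]

/-- If a meromorphic map of the bidisc maps a real hypersurface into a strongly pseudoconvex one,
then it is given by the Cauchy integral over circles that avoid its poles. -/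
lemma eq_smul_circleIntegral {k : ℕ} {ρ δ R : ℝ} (hρ : 0 < ρ) (hR : 0 < R) (hRδ : R < δ)
    {r : ℂ × ℂ → ℝ} (hr : AnalyticAt ℝ r (0, 0))
    (hr0 : r (0, 0) = 0) (hd : fderiv ℝ r (0, 0) (0, Complex.I) ≠ 0)
    {r' : Cn k → ℝ} {q : Cn k} (hr' : AnalyticAt ℝ r' q)
    (hlevi : ∀ v, v ≠ 0 → IsComplexTangent r' q v → 0 < leviForm r' q v)
    {f : ℂ × ℂ → Cn k} {g : ℂ × ℂ → ℂ}
    (hf : AnalyticOnNhd ℂ f (Metric.ball 0 ρ ×ˢ Metric.ball 0 δ))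
    (hg : AnalyticOnNhd ℂ g (Metric.ball 0 ρ ×ˢ Metric.ball 0 δ))
    (hg0 : ∀ z ∈ Metric.ball (0 : ℂ) δ, z ≠ 0 → g (0, z) ≠ 0)
    (hgR : ∀ t ∈ Metric.ball (0 : ℂ) ρ, ∀ ζ ∈ Metric.sphere (0 : ℂ) R, g (t, ζ) ≠ 0)
    (hmap : ∀ᶠ p in 𝓝 ((0 : ℂ), (0 : ℂ)), r p = 0 → g p ≠ 0 → r' ((g p)⁻¹ • f p) = 0)
    (hlim : Filter.Tendsto (fun p => (g p)⁻¹ • f p) (𝓝[{p | r p = 0 ∧ g p ≠ 0}] (0, 0)) (𝓝 q))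
    {t : ℂ} (ht : t ∈ Metric.ball (0 : ℂ) ρ) :
    f (t, 0) = g (t, 0) • (2 * Real.pi * Complex.I : ℂ)⁻¹ •
      ∮ ζ in C(0, R), (ζ - 0)⁻¹ • (g (t, ζ))⁻¹ • f (t, ζ) := by
  have hδ : 0 < δ := hR.trans hRδ
  have h0' : (0 : ℂ) ∈ Metric.ball (0 : ℂ) δ := Metric.mem_ball_self hδ
  have hsph : ∀ ζ ∈ Metric.sphere (0 : ℂ) R, ζ ∈ Metric.ball (0 : ℂ) δ ∧ ζ ≠ 0 := fun ζ hζ =>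
    ⟨Metric.closedBall_subset_ball hRδ (Metric.sphere_subset_closedBall hζ),
      Metric.ne_of_mem_sphere hζ hR.ne'⟩
  set C : (ℂ × ℂ → Cn k) → ℂ → Cn k := fun h t => (2 * Real.pi * Complex.I : ℂ)⁻¹ •
      ∮ ζ in C(0, R), (ζ - 0)⁻¹ • (g (t, ζ))⁻¹ • h (t, ζ) with hC
  have hCa : ∀ h : ℂ × ℂ → Cn k, AnalyticOnNhd ℂ h (Metric.ball 0 ρ ×ˢ Metric.ball 0 δ) →
      AnalyticOnNhd ℂ (fun t => h (t, 0) - g (t, 0) • C h t) (Metric.ball 0 ρ) := by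
    intro h hh t ht
    have hpair : AnalyticAt ℂ (fun t : ℂ => (t, (0 : ℂ))) t := by fun_prop
    have e1 : AnalyticAt ℂ (fun t => h (t, 0)) t :=
      AnalyticAt.fun_comp (g := h) (hh _ ⟨ht, h0'⟩) hpair
    have e2 : AnalyticAt ℂ (fun t => g (t, 0)) t :=
      AnalyticAt.fun_comp (g := g) (hg _ ⟨ht, h0'⟩) hpair
    have e3 : AnalyticAt ℂ (fun t => ∮ ζ in C(0, R), (ζ - 0)⁻¹ • (g (t, ζ))⁻¹ • h (t, ζ)) t := by
      refine analyticAt_circleIntegral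
        (h := fun x : ℂ × ℂ => (x.2 - 0)⁻¹ • (g x)⁻¹ • h x) hR.le fun ζ hζ => ?_
      have hmem : (t, ζ) ∈ Metric.ball (0 : ℂ) ρ ×ˢ Metric.ball (0 : ℂ) δ := ⟨ht, (hsph ζ hζ).1⟩
      refine AnalyticAt.fun_smul ?_ (((hg _ hmem).fun_inv (hgR t ht ζ hζ)).fun_smul (hh _ hmem))
      exact (analyticAt_snd.fun_sub analyticAt_const).fun_inv
        (by simpa using (hsph ζ hζ).2)
    exact e1.fun_sub (e2.fun_smul (e3.fun_const_smul))
  have hΔ := hCa f hf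
  have hzero : ∀ᶠ t in 𝓝 (0 : ℂ), f (t, 0) - g (t, 0) • C f t = 0 := by
    have h0 : (0 : ℂ) ∈ Metric.ball (0 : ℂ) ρ := Metric.mem_ball_self hρ
    -- The difference is shown to vanish to every order at `t = 0`; the exponent `l + 1` is used
    -- because the expansion requires a nonzero order.
    rw [← analyticOrderAt_eq_top, ENat.eq_top_iff_forall_ge]
    intro l
    refine le_trans (b := ((l + 1 : ℕ) : ℕ∞)) (by exact_mod_cast Nat.le_succ l) ?_
    rw [natCast_le_analyticOrderAt (hΔ 0 h0)]
    obtain ⟨A, B, hA, hB, -, hfA⟩ := exists_analyticOnNhd_expansion hρ hδ hr hr0 hd hr' hlevi hf hg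
      hg0 hmap hlim l.succ_ne_zero
    -- With `f = g A + t ^ (l + 1) B` the contributions of `A` cancel by Cauchy's formula, leaving
    -- `t ^ (l + 1)` times the same expression for `B`.
    refine ⟨_, hCa B hB 0 h0, ?_⟩
    filter_upwards [Metric.isOpen_ball.mem_nhds h0] with t ht
    have hcauchy : (∮ ζ in C(0, R), (ζ - 0)⁻¹ • A (t, ζ)) =
        (2 * Real.pi * Complex.I : ℂ) • A (t, 0) := by
      refine DifferentiableOn.circleIntegral_sub_inv_smul (f := fun ζ => A (t, ζ)) ?_
        (Metric.mem_ball_self hR)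
      intro ζ hζ
      have e : AnalyticAt ℂ (fun ζ => A (t, ζ)) ζ :=
        AnalyticAt.fun_comp (g := A) (f := fun ζ : ℂ => (t, ζ))
          (hA _ ⟨ht, Metric.closedBall_subset_ball hRδ hζ⟩) (by fun_prop)
      exact e.differentiableAt.differentiableWithinAt
    have hcont : ∀ h : ℂ × ℂ → Cn k, AnalyticOnNhd ℂ h (Metric.ball 0 ρ ×ˢ Metric.ball 0 δ) →
        ContinuousOn (fun ζ => h (t, ζ)) (Metric.sphere 0 R) := fun h hh =>
      hh.continuousOn.comp (by fun_prop) fun ζ hζ => ⟨ht, (hsph ζ hζ).1⟩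
    have hinv : ContinuousOn (fun ζ : ℂ => (ζ - 0)⁻¹) (Metric.sphere 0 R) :=
      ContinuousOn.inv₀ (by fun_prop) fun ζ hζ => by simpa using (hsph ζ hζ).2
    have hginv : ContinuousOn (fun ζ : ℂ => (g (t, ζ))⁻¹) (Metric.sphere 0 R) :=
      ContinuousOn.inv₀ (hg.continuousOn.comp (by fun_prop) fun ζ hζ => ⟨ht, (hsph ζ hζ).1⟩)
        fun ζ hζ => hgR t ht ζ hζ
    have hsplit : (∮ ζ in C(0, R), (ζ - 0)⁻¹ • (g (t, ζ))⁻¹ • f (t, ζ)) =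
        (∮ ζ in C(0, R), (ζ - 0)⁻¹ • A (t, ζ)) +
          t ^ (l + 1) • ∮ ζ in C(0, R), (ζ - 0)⁻¹ • (g (t, ζ))⁻¹ • B (t, ζ) := by
      rw [← circleIntegral.integral_smul, ← circleIntegral.integral_add]
      · refine circleIntegral.integral_congr hR.le fun ζ hζ => ?_
        rw [hfA (t, ζ) ⟨ht, (hsph ζ hζ).1⟩, smul_add, inv_smul_smul₀ (hgR t ht ζ hζ), smul_add,
          smul_comm _ (t ^ (l + 1)), smul_comm _ (t ^ (l + 1))]
      · exact (hinv.smul (hcont A hA)).circleIntegrable hR.le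
      · exact ContinuousOn.circleIntegrable hR.le
          ((hinv.fun_smul (hginv.fun_smul (hcont B hB))).fun_const_smul (t ^ (l + 1)))
    simp only [hC, sub_zero (t : ℂ)]
    rw [hsplit, hcauchy, hfA (t, 0) ⟨ht, h0'⟩, smul_add,
      inv_smul_smul₀ Complex.two_pi_I_ne_zero, smul_add, add_sub_add_left_eq_sub, smul_sub,
      smul_comm _ (t ^ (l + 1)), smul_comm _ (t ^ (l + 1))]
  have := hΔ.eqOn_zero_of_preconnected_of_eventuallyEq_zero
    (convex_ball (0 : ℂ) ρ).isPreconnected (Metric.mem_ball_self hρ) hzero ht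
  exact sub_eq_zero.1 this

/-! ### Slicing: the extension in `ℂⁿ` -/

open Filter in
/-- A holomorphic function that vanishes on no open set is not identically zero on some complex
line through a given point that is transverse to a given real hypersurface. -/
lemma exists_transverse_line_not_eventually_eq_zero {E : Type*} [NormedAddCommGroup E]
    [NormedSpace ℂ E] {p : E} {g : E → ℂ} {V : Set E} (hV : IsOpen V) (hpV : p ∈ V)
    (hg : AnalyticOnNhd ℂ g V) (hgV : V ⊆ closure {z ∈ V | g z ≠ 0}) {ℓ : E →L[ℝ] ℝ} (hℓ : ℓ ≠ 0) :
    ∃ e : E, ℓ (Complex.I • e) ≠ 0 ∧ ¬ ∀ᶠ ζ : ℂ in 𝓝 0, g (p + ζ • e) = 0 := by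
  obtain ⟨ε, hε, hball⟩ := Metric.isOpen_iff.1 hV p hpV
  obtain ⟨v, hv⟩ : ∃ v, ℓ v ≠ 0 := by
    by_contra! h
    exact hℓ (ContinuousLinearMap.ext h)
  -- `O` collects the points `z` near `p` for which `z - p` is transverse. It is open, nonempty and
  -- inside `V`, so it contains a point with `g z ≠ 0`; then `e = z - p` works, as `g (p + ζ e) ≠ 0`
  -- at `ζ = 1`.
  set O : Set E := Metric.ball p ε ∩ {z | ℓ (Complex.I • (z - p)) ≠ 0} with hO
  have hOo : IsOpen O := by
    refine Metric.isOpen_ball.inter (isOpen_ne_fun ?_ continuous_const)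
    exact ℓ.continuous.comp (by fun_prop)
  obtain ⟨z₀, hz₀⟩ : O.Nonempty := by
    have h1 : Tendsto (fun s : ℝ => p + s • ((-Complex.I) • v)) (𝓝[≠] 0) (𝓝 p) := by
      have h2 : Continuous fun s : ℝ => p + s • ((-Complex.I) • v) := by fun_prop
      have h3 := h2.tendsto 0
      rw [zero_smul, add_zero] at h3
      exact h3.mono_left nhdsWithin_le_nhds
    have hne : ∀ᶠ s : ℝ in 𝓝[≠] 0, s ≠ 0 := self_mem_nhdsWithin
    obtain ⟨s, hs, hs0⟩ := ((h1.eventually (Metric.ball_mem_nhds p hε)).and hne).exists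
    refine ⟨_, hs, ?_⟩
    have h4 : Complex.I • (p + s • ((-Complex.I) • v) - p) = s • v := by
      rw [add_sub_cancel_left, smul_comm, smul_smul]
      simp
    rw [mem_ofPred_eq, h4, map_smul, smul_eq_mul]
    exact mul_ne_zero hs0 hv
  obtain ⟨z, ⟨hzb, hzℓ⟩, -, hgz⟩ := mem_closure_iff.1 (hgV (hball hz₀.1)) O hOo hz₀
  refine ⟨z - p, hzℓ, fun h => hgz ?_⟩
  set S : Set ℂ := {ζ : ℂ | p + ζ • (z - p) ∈ Metric.ball p ε} with hS
  have hSc : Convex ℝ S := by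
    have h1 : S = (fun ζ : ℂ => ζ • (z - p)) ⁻¹' Metric.ball 0 ε := by
      ext ζ
      simp [hS]
    rw [h1]
    exact (convex_ball (0 : E) ε).is_linear_preimage
      ⟨fun a b => add_smul a b _, fun c a => smul_assoc c a _⟩
  have h0 : (0 : ℂ) ∈ S := by simpa [hS] using hε
  have h1 : (1 : ℂ) ∈ S := by simpa [hS, dist_eq_norm] using hzb
  have hga : AnalyticOnNhd ℂ (fun ζ : ℂ => g (p + ζ • (z - p))) S := fun ζ hζ =>
    AnalyticAt.fun_comp (g := g) (f := fun ζ : ℂ => p + ζ • (z - p)) (hg _ (hball hζ))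
      (by fun_prop)
  simpa using hga.eqOn_zero_of_preconnected_of_eventuallyEq_zero hSc.isPreconnected h0 h h1

open Filter in
/-- A meromorphic map that maps a real analytic hypersurface into a strongly pseudoconvex one
extends holomorphically to each point of the hypersurface at which it is continuous along it. -/
lemma exists_analyticAt_eq_smul {n k : ℕ} {p : Cn n} {q : Cn k} {V : Set (Cn n)} (hV : IsOpen V)
    (hpV : p ∈ V) {f : Cn n → Cn k} {g : Cn n → ℂ} (hf : AnalyticOnNhd ℂ f V)
    (hg : AnalyticOnNhd ℂ g V) (hgV : V ⊆ closure {z ∈ V | g z ≠ 0})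
    {r : Cn n → ℝ} (hr : AnalyticAt ℝ r p) (hr0 : r p = 0) (hd : fderiv ℝ r p ≠ 0)
    {r' : Cn k → ℝ} (hr' : AnalyticAt ℝ r' q)
    (hlevi : ∀ v, v ≠ 0 → IsComplexTangent r' q v → 0 < leviForm r' q v)
    (hmap : ∀ᶠ z in 𝓝 p, r z = 0 → g z ≠ 0 → r' ((g z)⁻¹ • f z) = 0)
    (hlim : Tendsto (fun z => (g z)⁻¹ • f z) (𝓝[{z | r z = 0 ∧ g z ≠ 0}] p) (𝓝 q)) :
    ∃ G : Cn n → Cn k, AnalyticAt ℂ G p ∧ ∀ᶠ z in 𝓝 p, f z = g z • G z := by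
  obtain ⟨e, he, hge⟩ := exists_transverse_line_not_eventually_eq_zero hV hpV hg hgV hd
  obtain ⟨ε, hε, hball⟩ := Metric.isOpen_iff.1 hV p hpV
  -- a disc in the transverse line
  obtain ⟨δ, hδ, hδ'⟩ : ∃ δ > 0, ∀ ζ ∈ Metric.ball (0 : ℂ) δ, ‖ζ • e‖ < ε / 2 ∧
      (ζ ≠ 0 → g (p + ζ • e) ≠ 0) := by
    have h1 : AnalyticAt ℂ (fun ζ : ℂ => g (p + ζ • e)) 0 :=
      AnalyticAt.fun_comp (g := g) (f := fun ζ : ℂ => p + ζ • e) (hg _ (by simpa using hpV))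
        (by fun_prop)
    have h2 := h1.eventually_eq_zero_or_eventually_ne_zero.resolve_left hge
    have h3 : ∀ᶠ ζ : ℂ in 𝓝 0, ‖ζ • e‖ < ε / 2 := by
      have h4 : Continuous fun ζ : ℂ => ‖ζ • e‖ := by fun_prop
      refine (h4.tendsto 0).eventually_lt_const ?_
      simpa using hε
    exact Metric.eventually_nhds_iff_ball.1 (h3.and (eventually_nhdsWithin_iff.1 h2))
  have hR : 0 < δ / 2 := half_pos hδ
  have hsph : ∀ ζ ∈ Metric.sphere (0 : ℂ) (δ / 2), ζ ∈ Metric.ball (0 : ℂ) δ ∧ ζ ≠ 0 := fun ζ hζ =>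
    ⟨Metric.closedBall_subset_ball (half_lt_self hδ) (Metric.sphere_subset_closedBall hζ),
      Metric.ne_of_mem_sphere hζ hR.ne'⟩
  have hmem : ∀ v : Cn n, ‖v‖ < ε / 2 → ∀ ζ ∈ Metric.ball (0 : ℂ) δ, p + v + ζ • e ∈ V := by
    intro v hv ζ hζ
    refine hball ?_
    rw [mem_ball_iff_norm, add_assoc, add_sub_cancel_left]
    linarith [norm_add_le v (ζ • e), (hδ' ζ hζ).1]
  have hmem0 : ∀ ζ ∈ Metric.ball (0 : ℂ) δ, p + ζ • e ∈ V := fun ζ hζ => by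
    simpa using hmem 0 (by simpa using hε) ζ hζ
  -- the denominator on nearby circles
  obtain ⟨η, hη, hη'⟩ : ∃ η > 0, ∀ v ∈ Metric.ball (0 : Cn n) η, ‖v‖ < ε / 2 ∧
      ∀ ζ ∈ Metric.sphere (0 : ℂ) (δ / 2), g (p + v + ζ • e) ≠ 0 := by
    have h1 : ∀ᶠ v : Cn n in 𝓝 0, ∀ ζ ∈ Metric.sphere (0 : ℂ) (δ / 2), g (p + v + ζ • e) ≠ 0 := by
      refine (isCompact_sphere (0 : ℂ) (δ / 2)).eventually_forall_of_forall_eventually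
        fun ζ hζ => ?_
      have h2 : ContinuousAt (fun x : Cn n × ℂ => g (p + x.1 + x.2 • e)) (0, ζ) :=
        ContinuousAt.comp (g := g) (f := fun x : Cn n × ℂ => p + x.1 + x.2 • e)
          (hg _ (by simpa using hmem0 ζ (hsph ζ hζ).1)).continuousAt (by fun_prop)
      refine h2.eventually_ne ?_
      simpa using (hδ' ζ (hsph ζ hζ).1).2 (hsph ζ hζ).2
    have h3 : ∀ᶠ v : Cn n in 𝓝 0, ‖v‖ < ε / 2 := by
      refine (continuous_norm.tendsto 0).eventually_lt_const ?_
      simpa using hε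
    exact Metric.eventually_nhds_iff_ball.1 (h3.and h1)
  refine ⟨fun z => (2 * Real.pi * Complex.I : ℂ)⁻¹ •
      ∮ ζ in C(0, δ / 2), (ζ - 0)⁻¹ • (g (z + ζ • e))⁻¹ • f (z + ζ • e), ?_, ?_⟩
  · refine AnalyticAt.fun_const_smul (analyticAt_circleIntegral
      (h := fun x : Cn n × ℂ => (x.2 - 0)⁻¹ • (g (x.1 + x.2 • e))⁻¹ • f (x.1 + x.2 • e))
      hR.le fun ζ hζ => ?_)
    have hm := hmem0 ζ (hsph ζ hζ).1
    have h1 : AnalyticAt ℂ (fun x : Cn n × ℂ => x.1 + x.2 • e) (p, ζ) := by fun_prop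
    have h2 : AnalyticAt ℂ (fun x : Cn n × ℂ => g (x.1 + x.2 • e)) (p, ζ) :=
      AnalyticAt.fun_comp (g := g) (hg _ hm) h1
    have h3 : AnalyticAt ℂ (fun x : Cn n × ℂ => f (x.1 + x.2 • e)) (p, ζ) :=
      AnalyticAt.fun_comp (g := f) (hf _ hm) h1
    have h4 : AnalyticAt ℂ (fun x : Cn n × ℂ => (x.2 - 0)⁻¹) (p, ζ) :=
      (analyticAt_snd.fun_sub analyticAt_const).fun_inv (by simpa using (hsph ζ hζ).2)
    exact h4.fun_smul ((h2.fun_inv ((hδ' ζ (hsph ζ hζ).1).2 (hsph ζ hζ).2)).fun_smul h3)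
  · filter_upwards [Metric.ball_mem_nhds p (half_pos hη)] with z hz
    -- The point `z` is `t = 1`, `ζ = 0` in the slice `p + t v + ζ e`. The radius `2` in `t`
    -- includes `1`, and `‖v‖ < η / 2` keeps `t v` in the ball of radius `η`.
    set v := z - p with hv
    have hvη : ‖v‖ < η / 2 := mem_ball_iff_norm.1 hz
    have htv : ∀ t ∈ Metric.ball (0 : ℂ) 2, t • v ∈ Metric.ball (0 : Cn n) η := by
      intro t ht
      rw [mem_ball_zero_iff] at ht ⊢
      rw [norm_smul]
      nlinarith [norm_nonneg v, norm_nonneg t]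
    have hslice : ∀ x ∈ Metric.ball (0 : ℂ) 2 ×ˢ Metric.ball (0 : ℂ) δ,
        p + x.1 • v + x.2 • e ∈ V := fun x hx => hmem _ (hη' _ (htv _ hx.1)).1 _ hx.2
    have hφ : ∀ x, AnalyticAt ℂ (fun x : ℂ × ℂ => p + x.1 • v + x.2 • e) x := by
      intro x; fun_prop
    have hφ0 : p + (0 : ℂ) • v + (0 : ℂ) • e = p := by simp
    have hφt : Tendsto (fun x : ℂ × ℂ => p + x.1 • v + x.2 • e) (𝓝 (0, 0)) (𝓝 p) := by
      have h1 := (hφ (0, 0)).continuousAt.tendsto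
      simp only [hφ0] at h1
      exact h1
    have hr1 : AnalyticAt ℝ (fun x : ℂ × ℂ => r (p + x.1 • v + x.2 • e)) (0, 0) :=
      AnalyticAt.fun_comp (g := r) (f := fun x : ℂ × ℂ => p + x.1 • v + x.2 • e)
        (by simpa only [hφ0] using hr) (hφ (0, 0)).restrictScalars
    have hder : fderiv ℝ (fun x : ℂ × ℂ => r (p + x.1 • v + x.2 • e)) (0, 0) (0, Complex.I) =
        fderiv ℝ r p (Complex.I • e) := by
      have h1 : HasFDerivAt (fun x : ℂ × ℂ => p + x.1 • v + x.2 • e)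
          (((ContinuousLinearMap.fst ℝ ℂ ℂ).smulRight v) +
            ((ContinuousLinearMap.snd ℝ ℂ ℂ).smulRight e)) (0, 0) := by
        refine HasFDerivAt.add (HasFDerivAt.const_add _ ?_) ?_
        · exact ((ContinuousLinearMap.fst ℝ ℂ ℂ).smulRight v).hasFDerivAt
        · exact ((ContinuousLinearMap.snd ℝ ℂ ℂ).smulRight e).hasFDerivAt
      have h2 : HasFDerivAt r (fderiv ℝ r p) (p + (0 : ℂ) • v + (0 : ℂ) • e) := by
        rw [hφ0]
        exact hr.differentiableAt.hasFDerivAt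
      have h3 := (h2.comp ((0 : ℂ), (0 : ℂ)) h1).fderiv
      rw [Function.comp_def] at h3
      rw [h3]
      simp
    have key := eq_smul_circleIntegral (ρ := 2) two_pos hR (half_lt_self hδ)
      (f := fun x => f (p + x.1 • v + x.2 • e)) (g := fun x => g (p + x.1 • v + x.2 • e))
      hr1 (by simpa only [hφ0] using hr0) (by rw [hder]; exact he) hr' hlevi
      (fun x hx => AnalyticAt.fun_comp (g := f) (hf _ (hslice x hx)) (hφ x))
      (fun x hx => AnalyticAt.fun_comp (g := g) (hg _ (hslice x hx)) (hφ x))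
      (fun ζ hζ hζ0 => by simpa using (hδ' ζ hζ).2 hζ0)
      (fun t ht ζ hζ => (hη' _ (htv t ht)).2 ζ hζ) (hφt.eventually hmap)
      (hlim.comp (tendsto_nhdsWithin_iff.2 ⟨hφt.mono_left nhdsWithin_le_nhds,
        self_mem_nhdsWithin⟩)) (t := 1) (by simp)
    simpa [hv] using key

/-! ### The extension theorem -/

theorem theorem1p1 (n m : ℕ) (hnN : n ≤ m + 1)
    (M : Set (Cn n)) (hM : IsRealAnalyticHypersurface M)
    (p : Cn n) (hpM : p ∈ M)
    (U : Set (Cn n)) (hU : IsOpen U) (hpU : p ∈ U)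
    (Ω : Set (Cn n)) (hΩ : IsOneSide M U Ω)
    (M' : Set (Cn (m + 1))) (hM' : IsRealAlgebraicHypersurface M')
    (hM'spc : IsStronglyPseudoconvex M')
    (q : Cn (m + 1))
    (P : MvPolynomial (Fin m ⊕ Fin m) ℂ) (hP : IsRealValued P)
    (hequiv : IsBirationallyEquivalentAt M' (modelHypersurface P) q)
    (W : Set (Cn (m + 1))) (hW : IsOpen W) (hqW : q ∈ W)
    (D : Set (Cn (m + 1))) (hD : IsOneSide M' W D)
    (F : Cn n → Cn (m + 1)) (hF : IsMeromorphicMapOn F U)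
    (hFhol : AnalyticOnNhd ℂ F Ω) (hFcont : ContinuousOn F (U ∩ closure Ω))
    (hFΩ : MapsTo F Ω D) (hFM : MapsTo F (M ∩ U) M') (hFp : F p = q) :
    ∃ (V : Set (Cn n)) (G : Cn n → Cn (m + 1)),
      IsOpen V ∧ p ∈ V ∧ V ⊆ U ∧ AnalyticOnNhd ℂ G V ∧
      EqOn G F (V ∩ closure Ω) ∧
      ∀ z ∈ V, AnalyticAt ℂ F z → G z = F z := by
  obtain ⟨hΩo, Ω', -, -, -, hMΩ, -⟩ := hΩ
  obtain ⟨V₀, f, g, hV₀, hpV₀, hV₀U, hf, hg, hgV₀, hFfg⟩ := hF p hpU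
  obtain ⟨V₁, r, hr⟩ := hM p hpM
  obtain ⟨V₂, r', hr', hlevi⟩ := hM'spc (F p) (hFM ⟨hpM, hpU⟩)
  -- Since `M ∩ U` lies in the closure of `Ω`, continuity up to the boundary gives the limit `F p`
  -- along `M`.
  have hMcl : M ∩ U ⊆ U ∩ closure Ω := fun z hz => ⟨hz.2, hMΩ hz⟩
  have hFp' : Filter.Tendsto F (𝓝[U ∩ closure Ω] p) (𝓝 (F p)) := hFcont p (hMcl ⟨hpM, hpU⟩)
  have hnear : ∀ᶠ z in 𝓝 p, z ∈ V₀ ∧ z ∈ V₁ :=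
    (hV₀.eventually_mem hpV₀).and (hr.isOpen.eventually_mem hr.mem)
  have hmap : ∀ᶠ z in 𝓝 p, r z = 0 → g z ≠ 0 → r' ((g z)⁻¹ • f z) = 0 := by
    filter_upwards [hnear, eventually_nhdsWithin_iff.1
      (hFp'.eventually (hr'.isOpen.mem_nhds hr'.mem))] with z ⟨h0, h1⟩ h2 h3 h4
    have hzM : z ∈ M ∩ U := ⟨(hr.zero_iff z h1).2 h3, hV₀U h0⟩
    rw [← hFfg z h0 h4]
    exact (hr'.zero_iff _ (h2 (hMcl hzM))).1 (hFM hzM)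
  have hlim : Filter.Tendsto (fun z => (g z)⁻¹ • f z) (𝓝[{z | r z = 0 ∧ g z ≠ 0}] p)
      (𝓝 (F p)) := by
    have h1 : ∀ᶠ z in 𝓝[{z | r z = 0 ∧ g z ≠ 0}] p,
        z ∈ U ∩ closure Ω ∧ F z = (g z)⁻¹ • f z := by
      filter_upwards [hnear.filter_mono nhdsWithin_le_nhds, self_mem_nhdsWithin]
        with z ⟨h0, h1⟩ ⟨h2, h3⟩
      exact ⟨hMcl ⟨(hr.zero_iff z h1).2 h2, hV₀U h0⟩, hFfg z h0 h3⟩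
    have h2 : 𝓝[{z | r z = 0 ∧ g z ≠ 0}] p ≤ 𝓝[U ∩ closure Ω] p :=
      le_inf nhdsWithin_le_nhds (Filter.le_principal_iff.2 (h1.mono fun z hz => hz.1))
    exact (hFp'.mono_left h2).congr' (h1.mono fun z hz => hz.2)
  obtain ⟨G, hG, hfG⟩ := exists_analyticAt_eq_smul hV₀ hpV₀ hf hg hgV₀ (hr.analytic p hr.mem)
    ((hr.zero_iff p hr.mem).1 hpM) hr.fderiv_ne_zero (hr'.analytic _ hr'.mem) hlevi hmap hlim
  obtain ⟨V, hVsub, hV, hpV⟩ := eventually_nhds_iff.1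
    ((hV₀.eventually_mem hpV₀).and (hG.eventually_analyticAt.and hfG))
  have hVV₀ : V ⊆ V₀ := fun z hz => (hVsub z hz).1
  have hGF : ∀ z ∈ V, g z ≠ 0 → G z = F z := fun z hz hgz => by
    rw [hFfg z (hVV₀ hz) hgz, (hVsub z hz).2.2, inv_smul_smul₀ hgz]
  -- Points of `O ∩ V` with `g ≠ 0` accumulate at `z`, so continuity transfers `G = F` to `z`. It is
  -- used with `O = Ω` on `V ∩ closure Ω` and with `O = univ` where `F` is analytic.
  have heq : ∀ O : Set (Cn n), IsOpen O → ∀ z ∈ V ∩ closure O,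
      ContinuousWithinAt F (O ∩ V) z → G z = F z := by
    intro O hO z hz hFz
    set T : Set (Cn n) := {y ∈ O ∩ V | g y ≠ 0} with hT
    have hzT : z ∈ closure T := by
      have h1 : O ∩ V ⊆ closure T := by
        intro y hy
        refine mem_closure_iff.2 fun A hA hyA => ?_
        obtain ⟨x, ⟨hxA, hx⟩, -, hgx⟩ := mem_closure_iff.1 (hgV₀ (hVV₀ hy.2)) _
          (hA.inter (hO.inter hV)) ⟨hyA, hy⟩
        exact ⟨x, hxA, hx, hgx⟩
      refine closure_minimal h1 isClosed_closure ?_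
      rw [inter_comm]
      exact hV.inter_closure hz
    have := mem_closure_iff_nhdsWithin_neBot.1 hzT
    have h2 : Filter.Tendsto G (𝓝[T] z) (𝓝 (G z)) :=
      (hVsub z hz.1).2.1.continuousAt.tendsto.mono_left nhdsWithin_le_nhds
    have h3 : Filter.Tendsto F (𝓝[T] z) (𝓝 (F z)) :=
      hFz.mono_left (nhdsWithin_mono _ fun y hy => hy.1)
    refine tendsto_nhds_unique_of_eventuallyEq h2 h3 ?_
    filter_upwards [self_mem_nhdsWithin] with y hy using hGF y hy.1.2 hy.2
  refine ⟨V, G, hV, hpV, hVV₀.trans hV₀U, fun z hz => (hVsub z hz).2.1, fun z hz => ?_,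
    fun z hz hFz => ?_⟩
  · refine heq Ω hΩo z hz ((hFcont z ⟨hV₀U (hVV₀ hz.1), hz.2⟩).mono fun y hy => ?_)
    exact ⟨hV₀U (hVV₀ hy.2), subset_closure hy.1⟩
  · exact heq univ isOpen_univ z ⟨hz, subset_closure (mem_univ z)⟩
      hFz.continuousAt.continuousWithinAt
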